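/- **Setting.** For each $I\ge 1$ consider a study with $I$ matched sets (all objects below may change with $I$). Set $i$ has $n_i\ge 1$ subjects and observed doses $z_{i1},\dots,z_{in_i}\in\mathbb R$; subject $j$ of set $i$ has potential outcomes $r_{ij}(z)$ and an unmeasured confounder $u_{ij}\in[0,1]$. Doses are assigned by permutations $\pi_i\in S_{n_i}$: $Z_{ij}=z_{i\pi_i(j)}$ and $R_{ij}=r_{ij}(Z_{ij})$. Fix $\gamma\ge 0$, $\Gamma=e^\gamma$. Under the Rosenbaum dose model with confounders $\mathbf u$, the permutations are independent across sets and $$p_{i\pi_i}=\frac{\exp\{\gamma\sum_j z_{i\pi_i(j)}u_{ij}\}}{\sum_{\pi_i'\in S_{n_i}}\exp\{\gamma\sum_j z_{i\pi_i'(j)}u_{ij}\}} ;$$ $P_{\mathbf u},E_{\mathbf u},\mathrm{Var}_{\mathbf u}$ refer to this law. Fisher's sharp null $H_F$ says that $r_{ij}(z)=r_{ij}(z')$ for all $i,j$ and all doses $z,z'$ of set $i$. **Test.** Let $q_{i1},q_{i2}:\mathbb R\to\mathbb R$ be given functions and $w_i\ge 0$ given set weights ($w_i\equiv 1$ for the plain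 mean, $w_i=In_i/N$ with $N=\sum_i n_i$ for size weighting; the two coincide when all $n_i$ are equal). Let $T_i=\sum_{j}q_{i1}(Z_{ij})q_{i2}(R_{ij})$ and $t_{i\pi}=\sum_j q_{i1}(z_{i\pi(j)})q_{i2}(R_{ij})$. Let $\mu_i^*$ be the maximum of $\sum_{\pi\in S_{n_i}}p_\pi t_{i\pi}$ over all $(p_\pi)$ with $\sum_\pi p_\pi=1$ and, for all $\pi,\pi'\in S_{n_i}$, $$\exp\Big\{\gamma\!\!\sum_{j:\,z_{i\pi(j)}<z_{i\pi'(j)}}\!\!(z_{i\pi(j)}-z_{i\pi'(j)})\Big\}\le \frac{p_\pi}{p_{\pi'}}\le \exp\Big\{\gamma\!\!\sum_{j:\,z_{i\pi(j)}>z_{i\pi'(j)}}\!\!(z_{i\pi(j)}-z_{i\pi'(j)})\Big\}.$$ Put $V_{F,i}=T_i-\mu_i^*$ and $V_F=I^{-1}\sum_i w_iV_{F,i}$; for $w_i\equiv1$ this is $I^{-1}\sum_i\sum_j q_{i1}(Z_{ij})q_{i2}(R_{ij})-I^{-1}\sum_i\mu_i^*$. Let $Q$ be a fixed $I\times L_I$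 matrix with hat matrix $H_Q=Q(Q^TQ)^{-1}Q^T=(h_{ik})$, let $y_i=V_{F,i}/\sqrt{1-h_{ii}}$, $W=\mathrm{diag}(w_1,\dots,w_I)$, $S_F^2(Q)=I^{-2}\,\mathbf yW(\mathcal I-H_Q)W\mathbf y^T$, and $$\overline p_F=1-\Phi\big(V_F/S_F(Q)\big),$$ where $\Phi$ is the standard normal distribution function. **Regularity conditions.** (a) For all large $I$: $L_I<I$, $Q$ has full column rank, and $\max_i h_{ii}\le 1-\delta$, with $\delta>0$ not depending on $I$. (b) $\mathrm{Var}_{\mathbf u}(V_F)>0$ for all large $I$, and $\sum_{i}E_{\mathbf u}[(I^{-1}w_iV_{F,i})^4]\big/\mathrm{Var}_{\mathbf u}(V_F)^2\to 0$ as $I\to\infty$. (For instance, this holds if $I^{-1}\sum_i E_{\mathbf u}[(w_iV_{F,i})^4]$ is bounded and $I\,\mathrm{Var}_{\mathbf u}(V_F)$ is bounded away from $0$.) **Theorem.** Let $H_F$ hold for every $I$ and let $\mathbf u$ be any (sequence of) confounders in $[0,1]^N$. Under the Rosenbaum dose model with parameter $\Gamma$ and confounders $\mathbf u$, if (a) and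 (b) hold, then for every $\alpha\in(0,1)$ $$\limsup_{I\to\infty}P_{\mathbf u}(\overline p_F\le\alpha)\le\alpha .$$ -/

import Mathlib

open Filter Topology

noncomputable section

namespace DoseSensitivity

/-! ### Quantities of one matched set with `n` subjects

A dose assignment is a permutation `π` of the index set: subject `j` receives the dose `z (π j)`.
Tied doses are treated as distinct objects, so there are always `n !` assignments. -/

section OneSet

variable {n : ℕ}

/-- Rosenbaum dose assignment probability of `π` in a matched set with doses `z`, unmeasured
confounders `u` and sensitivity parameter `γ`. -/
def permProb (γ : ℝ) (z u : Fin n → ℝ) (π : Equiv.Perm (Fin n)) : ℝ :=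
  Real.exp (γ * ∑ j, z (π j) * u j) /
    ∑ π' : Equiv.Perm (Fin n), Real.exp (γ * ∑ j, z (π' j) * u j)

/-- The set statistic `T_i = ∑ j, q₁ (Z j) * q₂ (R j)` at doses `Z` and outcomes `R`. -/
def setStat (q₁ q₂ : ℝ → ℝ) (Z R : Fin n → ℝ) : ℝ :=
  ∑ j, q₁ (Z j) * q₂ (R j)

/-- Lower bound for the ratio of the probabilities of `π` and `π'`. -/
def ratioLower (γ : ℝ) (z : Fin n → ℝ) (π π' : Equiv.Perm (Fin n)) : ℝ :=
  Real.exp (γ * ∑ j with z (π j) < z (π' j), (z (π j) - z (π' j)))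

/-- Upper bound for the ratio of the probabilities of `π` and `π'`. -/
def ratioUpper (γ : ℝ) (z : Fin n → ℝ) (π π' : Equiv.Perm (Fin n)) : ℝ :=
  Real.exp (γ * ∑ j with z (π' j) < z (π j), (z (π j) - z (π' j)))

/-- Feasible points of the linear program: total mass one, and the ratio bounds. (Nonnegativity
follows, since the lower ratio bounds are positive.) -/
def lpFeasible (γ : ℝ) (z : Fin n → ℝ) : Set (Equiv.Perm (Fin n) → ℝ) :=
  {p | ∑ π, p π = 1 ∧
    ∀ π π', p π / p π' ∈ Set.Icc (ratioLower γ z π π') (ratioUpper γ z π π')}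

/-- Optimal value `μ_i^*` of the linear program: the largest value of `∑ π, p π * t π` over the
feasible `p`, where `t π` is the value of the set statistic under the assignment `π` with the
outcomes `R` held fixed, as the sharp null prescribes. -/
def lpOptimum (γ : ℝ) (q₁ q₂ : ℝ → ℝ) (z R : Fin n → ℝ) : ℝ :=
  sSup ((fun p : Equiv.Perm (Fin n) → ℝ =>
    ∑ π, p π * setStat q₁ q₂ (fun j => z (π j)) R) '' lpFeasible γ z)

end OneSet

/-- A matched study with `I` matched sets: set sizes, observed doses (whose permutations within the
sets are the possible assignments) and potential outcomes `r i j z` of subject `j` of set `i`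
under dose `z`. -/
structure MatchedStudy (I : ℕ) where
  n : Fin I → ℕ
  n_pos : ∀ i, 0 < n i
  z : (i : Fin I) → Fin (n i) → ℝ
  r : (i : Fin I) → Fin (n i) → ℝ → ℝ

namespace MatchedStudy

variable {I : ℕ} (D : MatchedStudy I)

/-- Fisher's sharp null hypothesis of no effect: no subject's outcome depends on which of the
doses of its matched set it receives. -/
def SharpNull : Prop :=
  ∀ i j k k', D.r i j (D.z i k) = D.r i j (D.z i k')

/-- A dose assignment of the whole study: one permutation in each matched set. -/
abbrev Assignment : Type := (i : Fin I) → Equiv.Perm (Fin (D.n i))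

/-- An unmeasured confounder value for every subject. -/
abbrev Confounder : Type := (i : Fin I) → Fin (D.n i) → ℝ

/-- Dose `Z_ij` received under the assignment. -/
def dose (π : D.Assignment) (i : Fin I) (j : Fin (D.n i)) : ℝ := D.z i (π i j)

/-- Observed outcome `R_ij = r_ij (Z_ij)` under the assignment. -/
def outcome (π : D.Assignment) (i : Fin I) (j : Fin (D.n i)) : ℝ := D.r i j (D.dose π i j)

/-- Probability of an assignment under the Rosenbaum model, independent across matched sets. -/
def assignProb (γ : ℝ) (u : D.Confounder) (π : D.Assignment) : ℝ :=
  ∏ i, permProb γ (D.z i) (u i) (π i)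

open Classical in
/-- `P_u (A)`. -/
def prob (γ : ℝ) (u : D.Confounder) (A : Set D.Assignment) : ℝ :=
  ∑ π with π ∈ A, D.assignProb γ u π

/-- `E_u [f]`. -/
def expect (γ : ℝ) (u : D.Confounder) (f : D.Assignment → ℝ) : ℝ :=
  ∑ π, D.assignProb γ u π * f π

/-- `Var_u (f)`. -/
def variance (γ : ℝ) (u : D.Confounder) (f : D.Assignment → ℝ) : ℝ :=
  D.expect γ u (fun π => (f π - D.expect γ u f) ^ 2)

/-- `V_{F,i} = T_i - μ_i^*`, computed from the doses and outcomes observed under `π`. -/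
def setV (γ : ℝ) (q₁ q₂ : Fin I → ℝ → ℝ) (π : D.Assignment) (i : Fin I) : ℝ :=
  setStat (q₁ i) (q₂ i) (D.dose π i) (D.outcome π i) -
    lpOptimum γ (q₁ i) (q₂ i) (D.z i) (D.outcome π i)

/-- `V_F = I⁻¹ ∑ i, w i * V_{F,i}`, with set weights `w` (the constant `1` for the plain mean). -/
def bigV (γ : ℝ) (q₁ q₂ : Fin I → ℝ → ℝ) (w : Fin I → ℝ) (π : D.Assignment) : ℝ :=
  (I : ℝ)⁻¹ * ∑ i, w i * D.setV γ q₁ q₂ π i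

end MatchedStudy

/-- The hat matrix `Q (Qᵀ Q)⁻¹ Qᵀ`. -/
def hatMatrix {I L : ℕ} (Q : Matrix (Fin I) (Fin L) ℝ) : Matrix (Fin I) (Fin I) ℝ :=
  Q * (Q.transpose * Q)⁻¹ * Q.transpose

namespace MatchedStudy

variable {I : ℕ} (D : MatchedStudy I)

/-- `y_{F,i} = V_{F,i} / √(1 - h_ii)`. -/
def leverageAdjusted (γ : ℝ) (q₁ q₂ : Fin I → ℝ → ℝ) {L : ℕ} (Q : Matrix (Fin I) (Fin L) ℝ)
    (π : D.Assignment) (i : Fin I) : ℝ :=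
  D.setV γ q₁ q₂ π i / Real.sqrt (1 - hatMatrix Q i i)

/-- The covariate-adjusted variance estimator `S_F²(Q) = I⁻² y W (1 - H_Q) W yᵀ` with
`W = diag w`. -/
def varEstimator (γ : ℝ) (q₁ q₂ : Fin I → ℝ → ℝ) (w : Fin I → ℝ) {L : ℕ}
    (Q : Matrix (Fin I) (Fin L) ℝ) (π : D.Assignment) : ℝ :=
  ((I : ℝ) ^ 2)⁻¹ *
    dotProduct (D.leverageAdjusted γ q₁ q₂ Q π)
      ((Matrix.diagonal w * (1 - hatMatrix Q) * Matrix.diagonal w).mulVec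
        (D.leverageAdjusted γ q₁ q₂ Q π))

/-- The bounding p-value `1 - Φ (V_F / S_F(Q))`. -/
def pBar (γ : ℝ) (q₁ q₂ : Fin I → ℝ → ℝ) (w : Fin I → ℝ) {L : ℕ}
    (Q : Matrix (Fin I) (Fin L) ℝ) (π : D.Assignment) : ℝ :=
  1 - ProbabilityTheory.cdf (ProbabilityTheory.gaussianReal 0 1)
    (D.bigV γ q₁ q₂ w π / Real.sqrt (D.varEstimator γ q₁ q₂ w Q π))

end MatchedStudy

/-- Regularity of a sequence of studies (one for each number `I` of matched sets) under the
confounders `u`: `V_F` is nondegenerate, and no matched set dominates, in the sense of Lyapunov's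
fourth moment condition on the contributions `I⁻¹ * w i * V_{F,i}` to `V_F`. -/
def MomentRegular (γ : ℝ) (D : (I : ℕ) → MatchedStudy I) (q₁ q₂ : (I : ℕ) → Fin I → ℝ → ℝ)
    (w : (I : ℕ) → Fin I → ℝ) (u : (I : ℕ) → (D I).Confounder) : Prop :=
  (∀ᶠ I in atTop, 0 < (D I).variance γ (u I) ((D I).bigV γ (q₁ I) (q₂ I) (w I))) ∧
  Tendsto (fun I : ℕ =>
    (∑ i, (D I).expect γ (u I)
      (fun π => ((I : ℝ)⁻¹ * (w I i * (D I).setV γ (q₁ I) (q₂ I) π i)) ^ 4)) /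
    ((D I).variance γ (u I) ((D I).bigV γ (q₁ I) (q₂ I) (w I))) ^ 2) atTop (𝓝 0)

/-- Regularity of a sequence of `I × L_I` adjustment matrices: `L_I < I`, full column rank, and
leverages bounded away from one. -/
def DesignRegular {L : ℕ → ℕ} (Q : (I : ℕ) → Matrix (Fin I) (Fin (L I)) ℝ) : Prop :=
  (∀ᶠ I in atTop, L I < I) ∧
  (∀ᶠ I in atTop, IsUnit ((Q I).transpose * Q I).det) ∧
  ∃ δ : ℝ, 0 < δ ∧ ∀ᶠ I in atTop, ∀ i, hatMatrix (Q I) i i ≤ 1 - δ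

end DoseSensitivity

end

/-! Under the sharp null the outcomes do not depend on the assignment, so each `μ_i^*` is a constant
and the `V_{F,i}` are independent. The true law `permProb` is feasible for the linear program
because `u` lies in `[0,1]`; hence every `V_{F,i}` has mean at most zero (`wMean_nullV_nonpos`).
Divide the contributions by the standard deviation of `V_F` and write them as `x_i = X_i + m_i`,
with `X_i` centred and `m_i ≤ 0`. The variances sum to one and the fourth moments sum to `o(1)`, so
`∑ X_i` is asymptotically normal (`tendsto_prodProb_of_lyapunov`). The variance estimator becomes a
quadratic form `xᵀBx`, where `B` is the residual projection rescaled to unit diagonal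
(`isVarForm_varCoeff`). Expanding, `xᵀBx = (off-diagonal part) + ∑ X_i² + 2 mᵀBX + mᵀBm`. The first
term is negligible, the second is close to one, and the cross term is negligible relative to `1 +
mᵀBm`. Since `mᵀBm ≥ 0`, the variance is not underestimated asymptotically. Overestimation could
hurt only for thresholds `a < 0`, but `mᵀBm` is of second order in the `m_i`, whereas the numerator
shifts down by the first-order amount `∑ |m_i|`, which dominates. So `prodProb_studentized_le`
bounds the studentized tail at `a` by the tail of `∑ X_i` at any `b < a`, plus `o(1)`; continuity of
`Φ` then lets both thresholds approach the critical value. -/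

noncomputable section

namespace DoseSensitivity

/-! ### Expectation under a finite product of weights -/

section ProductExpectation

variable {ι : Type*} [Fintype ι] [DecidableEq ι] {Ω : ι → Type*} [∀ i, Fintype (Ω i)]

/-- Expectation of `f` under the product of the weights `p i`. -/
def prodExpect (p : ∀ i, Ω i → ℝ) (f : (∀ i, Ω i) → ℝ) : ℝ :=
  ∑ ω, (∏ i, p i (ω i)) * f ω

/-- Expectation under a single weight. -/
def wMean {A : Type*} [Fintype A] (p : A → ℝ) (f : A → ℝ) : ℝ := ∑ a, p a * f a

/-- Nonnegative weights of total mass one in every factor. -/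
structure IsWeight (p : ∀ i, Ω i → ℝ) : Prop where
  nonneg : ∀ i a, 0 ≤ p i a
  sum_eq_one : ∀ i, ∑ a, p i a = 1

/-! ### Moment inequalities under a single weight. -/

section wMean
variable {A : Type*} [Fintype A] (p : A → ℝ)

lemma wMean_add (f g : A → ℝ) : wMean p (fun a => f a + g a) = wMean p f + wMean p g := by
  simp [wMean, mul_add, Finset.sum_add_distrib]

lemma wMean_sub (f g : A → ℝ) : wMean p (fun a => f a - g a) = wMean p f - wMean p g := by
  simp [wMean, mul_sub, Finset.sum_sub_distrib]

lemma wMean_const_mul (c : ℝ) (f : A → ℝ) : wMean p (fun a => c * f a) = c * wMean p f := by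
  simp only [wMean, Finset.mul_sum]
  exact Finset.sum_congr rfl fun _ _ => by ring

lemma wMean_const (h1 : ∑ a, p a = 1) (c : ℝ) : wMean p (fun _ => c) = c := by
  simp [wMean, ← Finset.sum_mul, h1]

lemma wMean_mono (h0 : ∀ a, 0 ≤ p a) {f g : A → ℝ} (h : ∀ a, f a ≤ g a) :
    wMean p f ≤ wMean p g :=
  Finset.sum_le_sum fun a _ => mul_le_mul_of_nonneg_left (h a) (h0 a)

lemma wMean_nonneg (h0 : ∀ a, 0 ≤ p a) {f : A → ℝ} (h : ∀ a, 0 ≤ f a) : 0 ≤ wMean p f :=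
  Finset.sum_nonneg fun a _ => mul_nonneg (h0 a) (h a)

lemma wMean_sub_const_sq (h1 : ∑ a, p a = 1) (f : A → ℝ) (c : ℝ) :
    wMean p (fun a => (f a - c) ^ 2) = wMean p (fun a => f a ^ 2) - 2 * c * wMean p f + c ^ 2 := by
  have : (fun a => (f a - c) ^ 2) = fun a => (f a ^ 2 - 2 * c * f a) + c ^ 2 := by
    funext a; ring
  rw [this, wMean_add, wMean_sub, wMean_const p h1, wMean_const_mul]

lemma sq_wMean_le (h0 : ∀ a, 0 ≤ p a) (h1 : ∑ a, p a = 1) (f : A → ℝ) :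
    wMean p f ^ 2 ≤ wMean p (fun a => f a ^ 2) := by
  have h := wMean_nonneg p h0 (f := fun a => (f a - wMean p f) ^ 2) fun _ => sq_nonneg _
  rw [wMean_sub_const_sq p h1] at h
  nlinarith

lemma wMean_pow_four_le (h0 : ∀ a, 0 ≤ p a) (h1 : ∑ a, p a = 1) (f : A → ℝ) :
    wMean p f ^ 4 ≤ wMean p (fun a => f a ^ 4) := by
  have h := sq_wMean_le p h0 h1 fun a => f a ^ 2
  have h' := pow_le_pow_left₀ (sq_nonneg _) (sq_wMean_le p h0 h1 f) 2
  simp only [← pow_mul] at h h'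
  norm_num at h h'
  exact h'.trans h

lemma wMean_centered_pow_four_le (h0 : ∀ a, 0 ≤ p a) (h1 : ∑ a, p a = 1) (f : A → ℝ) :
    wMean p (fun a => (f a - wMean p f) ^ 4) ≤ 16 * wMean p (fun a => f a ^ 4) := by
  have h : wMean p (fun a => (f a - wMean p f) ^ 4) ≤
      -- Pointwise `(x - y)^4 ≤ 8x^4 + 8y^4`; Jensen then absorbs the second term, giving 16.
      wMean p (fun a => 8 * f a ^ 4 + 8 * wMean p f ^ 4) := by
    refine wMean_mono p h0 fun a => ?_
    generalize f a = x
    generalize wMean p f = y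
    nlinarith [sq_nonneg (x + y), sq_nonneg (x ^ 2 - y ^ 2), sq_nonneg (x - y),
      sq_nonneg ((x + y) ^ 2), mul_nonneg (sq_nonneg (x + y)) (sq_nonneg (x - y)),
      mul_nonneg (sq_nonneg (x + y)) (sq_nonneg x), mul_nonneg (sq_nonneg (x + y)) (sq_nonneg y)]
  rw [wMean_add, wMean_const p h1, wMean_const_mul] at h
  linarith [wMean_pow_four_le p h0 h1 f]

end wMean

variable {p : ∀ i, Ω i → ℝ}

lemma prodExpect_add (f g : (∀ i, Ω i) → ℝ) :
    prodExpect p (fun ω => f ω + g ω) = prodExpect p f + prodExpect p g := by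
  simp [prodExpect, mul_add, Finset.sum_add_distrib]

lemma prodExpect_const_mul (c : ℝ) (f : (∀ i, Ω i) → ℝ) :
    prodExpect p (fun ω => c * f ω) = c * prodExpect p f := by
  simp only [prodExpect, Finset.mul_sum]
  exact Finset.sum_congr rfl fun _ _ => by ring

lemma prodExpect_sum {κ : Type*} (s : Finset κ) (f : κ → (∀ i, Ω i) → ℝ) :
    prodExpect p (fun ω => ∑ k ∈ s, f k ω) = ∑ k ∈ s, prodExpect p (f k) := by
  simp only [prodExpect, Finset.mul_sum]
  exact Finset.sum_comm

lemma prodExpect_mono (hp : IsWeight p) {f g : (∀ i, Ω i) → ℝ} (h : ∀ ω, f ω ≤ g ω) :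
    prodExpect p f ≤ prodExpect p g :=
  Finset.sum_le_sum fun ω _ => mul_le_mul_of_nonneg_left (h ω)
    (Finset.prod_nonneg fun i _ => hp.nonneg i _)

/-- The semiring is general because the factorization serves real moments and also complex
characteristic functions. -/
lemma sum_prod_mul_prod {R : Type*} [CommSemiring R] (a b : ∀ i, Ω i → R) :
    ∑ ω : ∀ i, Ω i, (∏ i, a i (ω i)) * ∏ i, b i (ω i) = ∏ i, ∑ x, a i x * b i x := by
  simp_rw [← Finset.prod_mul_distrib]
  rw [Finset.prod_univ_sum, Fintype.piFinset_univ]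

lemma prodExpect_prod (f : ∀ i, Ω i → ℝ) :
    prodExpect p (fun ω => ∏ i, f i (ω i)) = ∏ i, wMean (p i) (f i) :=
  sum_prod_mul_prod p f

lemma prodExpect_const (hp : IsWeight p) (c : ℝ) : prodExpect p (fun _ => c) = c := by
  have h := prodExpect_prod (p := p) fun _ _ => (1 : ℝ)
  simp only [Finset.prod_const_one, wMean_const _ (hp.sum_eq_one _)] at h
  simpa [h] using prodExpect_const_mul (p := p) c fun _ => (1 : ℝ)

lemma prodExpect_eval (hp : IsWeight p) (i : ι) (g : Ω i → ℝ) :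
    prodExpect p (fun ω => g (ω i)) = wMean (p i) g := by
  -- A function of one coordinate is a product over all coordinates with the other factors equal to
  -- one.
  let f : ∀ k, Ω k → ℝ := fun k a => if h : k = i then g (h ▸ a) else 1
  have hf : ∀ ω : ∀ k, Ω k, ∏ k, f k (ω k) = g (ω i) := fun ω => by
    rw [Finset.prod_eq_single i (fun k _ hk => by simp [f, hk]) (by simp)]
    simp [f]
  have h := prodExpect_prod (p := p) f
  simp only [hf] at h
  rw [h, Finset.prod_eq_single i _ (by simp)]
  · simp [f]
  · intro k _ hk
    simp only [f, hk, dite_false]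
    exact wMean_const _ (hp.sum_eq_one k) 1

/-- The probability of `A` under the product of the weights `p i`. -/
def prodProb (p : ∀ i, Ω i → ℝ) (A : Set (∀ i, Ω i)) : ℝ := prodExpect p (A.indicator fun _ => 1)

lemma prodProb_mono (hp : IsWeight p) {A B : Set (∀ i, Ω i)} (h : A ⊆ B) :
    prodProb p A ≤ prodProb p B :=
  prodExpect_mono hp fun _ => Set.indicator_le_indicator_of_subset h (fun _ => zero_le_one) _

lemma prodProb_nonneg (hp : IsWeight p) (A : Set (∀ i, Ω i)) : 0 ≤ prodProb p A := by
  have h := prodExpect_mono hp (f := fun _ => 0) (g := A.indicator fun _ => 1)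
    fun ω => Set.indicator_nonneg (fun _ _ => zero_le_one) ω
  rwa [prodExpect_const hp] at h

lemma prodProb_union_le (hp : IsWeight p) (A B : Set (∀ i, Ω i)) :
    prodProb p (A ∪ B) ≤ prodProb p A + prodProb p B := by
  rw [prodProb, prodProb, prodProb, ← prodExpect_add]
  refine prodExpect_mono hp fun ω => ?_
  by_cases hA : ω ∈ A <;> by_cases hB : ω ∈ B <;> simp [hA, hB]

/-- Markov's inequality. -/
lemma mul_prodProb_le (hp : IsWeight p) {f : (∀ i, Ω i) → ℝ} (hf : ∀ ω, 0 ≤ f ω) (c : ℝ) :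
    c * prodProb p {ω | c < f ω} ≤ prodExpect p f := by
  rw [prodProb, ← prodExpect_const_mul]
  refine prodExpect_mono hp fun ω => ?_
  by_cases h : c < f ω
  · simp [h, h.le]
  · simp [h, hf ω]

/-! ### Second moments of linear and quadratic forms in centred independent variables -/

variable {X : ∀ i, Ω i → ℝ}

lemma prodExpect_mul_eq_zero (hX : ∀ i, wMean (p i) (X i) = 0) {i k : ι} (h : i ≠ k) :
    prodExpect p (fun ω => X i (ω i) * X k (ω k)) = 0 := by
  have e : ∀ ω : ∀ i, Ω i, X i (ω i) * X k (ω k) = ∏ m, ((if m = i then X m (ω m) else 1) *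
      (if m = k then X m (ω m) else 1)) := fun ω => by
    simp only [Finset.prod_mul_distrib, Finset.prod_ite_eq', Finset.mem_univ, if_true]
  simp only [e]
  rw [prodExpect_prod fun m a => (if m = i then X m a else 1) * (if m = k then X m a else 1)]
  refine Finset.prod_eq_zero (Finset.mem_univ i) ?_
  simpa [h] using hX i

/-- An index occurring only once contributes the factor `E X_i = 0`; the other three may coincide.
-/
lemma prodExpect_four_eq_zero (hX : ∀ i, wMean (p i) (X i) = 0) {i k j l : ι}
    (hk : i ≠ k) (hj : i ≠ j) (hl : i ≠ l) :
    prodExpect p (fun ω => X i (ω i) * X k (ω k) * (X j (ω j) * X l (ω l))) = 0 := by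
  have e : ∀ ω : ∀ i, Ω i, X i (ω i) * X k (ω k) * (X j (ω j) * X l (ω l)) =
      ∏ m, ((if m = i then X m (ω m) else 1) * (if m = k then X m (ω m) else 1) *
      ((if m = j then X m (ω m) else 1) * (if m = l then X m (ω m) else 1))) := fun ω => by
    simp only [Finset.prod_mul_distrib, Finset.prod_ite_eq', Finset.mem_univ, if_true]
  simp only [e]
  rw [prodExpect_prod fun m a => (if m = i then X m a else 1) * (if m = k then X m a else 1) *
      ((if m = j then X m a else 1) * (if m = l then X m a else 1))]
  refine Finset.prod_eq_zero (Finset.mem_univ i) ?_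
  simpa [hk, hj, hl] using hX i

lemma prodExpect_sq_mul_sq (hp : IsWeight p) {i k : ι} (h : i ≠ k) :
    prodExpect p (fun ω => X i (ω i) ^ 2 * X k (ω k) ^ 2) =
      wMean (p i) (fun a => X i a ^ 2) * wMean (p k) (fun a => X k a ^ 2) := by
  have e : ∀ ω : ∀ i, Ω i, X i (ω i) ^ 2 * X k (ω k) ^ 2 =
      ∏ m, ((if m = i then X m (ω m) ^ 2 else 1) * (if m = k then X m (ω m) ^ 2 else 1)) :=
    fun ω => by simp only [Finset.prod_mul_distrib, Finset.prod_ite_eq', Finset.mem_univ, if_true]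
  simp only [e]
  rw [prodExpect_prod fun m a => (if m = i then X m a ^ 2 else 1) *
    (if m = k then X m a ^ 2 else 1)]
  have e' : ∀ m, wMean (p m) (fun a => (if m = i then X m a ^ 2 else 1) *
      (if m = k then X m a ^ 2 else 1)) =
      (if m = i then wMean (p m) (fun a => X m a ^ 2) else 1) *
      (if m = k then wMean (p m) (fun a => X m a ^ 2) else 1) := fun m => by
    by_cases h1 : m = i
    · have h2 : m ≠ k := fun h2 => h (h1.symm.trans h2)
      simp [h1, h]
    · by_cases h2 : m = k
      · subst h2; simp [h1]
      · simpa [h1, h2] using wMean_const _ (hp.sum_eq_one m) 1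
  simp only [e', Finset.prod_mul_distrib, Finset.prod_ite_eq', Finset.mem_univ, if_true]

lemma prodExpect_sum_sq (hp : IsWeight p) (hX : ∀ i, wMean (p i) (X i) = 0) :
    prodExpect p (fun ω => (∑ i, X i (ω i)) ^ 2) = ∑ i, wMean (p i) (fun a => X i a ^ 2) := by
  simp only [sq, Finset.sum_mul_sum, prodExpect_sum]
  refine Finset.sum_congr rfl fun i _ => ?_
  rw [Finset.sum_eq_single i _ (by simp)]
  · exact prodExpect_eval hp i fun a => X i a * X i a
  · exact fun k _ hk => prodExpect_mul_eq_zero hX hk.symm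

/-- In the expanded square only `(j, l) = (i, k)` and `(j, l) = (k, i)` survive; by symmetry of `B`
they contribute equally, whence the factor 2. -/
lemma prodExpect_offDiag_sq (hp : IsWeight p) (hX : ∀ i, wMean (p i) (X i) = 0)
    {B : ι → ι → ℝ} (hB : ∀ i k, B i k = B k i) (hB0 : ∀ i, B i i = 0) :
    prodExpect p (fun ω => (∑ i, ∑ k, B i k * (X i (ω i) * X k (ω k))) ^ 2) =
      2 * ∑ i, ∑ k, B i k ^ 2 *
        (wMean (p i) (fun a => X i a ^ 2) * wMean (p k) (fun a => X k a ^ 2)) := by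
  have e : ∀ ω : ∀ i, Ω i, (∑ i, ∑ k, B i k * (X i (ω i) * X k (ω k))) ^ 2 =
      ∑ i, ∑ k, ∑ j, ∑ l, B i k * B j l *
        (X i (ω i) * X k (ω k) * (X j (ω j) * X l (ω l))) := fun ω => by
    simp only [sq, Finset.sum_mul, Finset.mul_sum]
    refine Finset.sum_congr rfl fun i _ => Finset.sum_congr rfl fun k _ =>
      Finset.sum_congr rfl fun j _ => Finset.sum_congr rfl fun l _ => by ring
  simp only [e, prodExpect_sum, prodExpect_const_mul, Finset.mul_sum]
  refine Finset.sum_congr rfl fun i _ => Finset.sum_congr rfl fun k _ => ?_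
  by_cases hik : i = k
  · subst hik; simp [hB0]
  set s := wMean (p i) (fun a => X i a ^ 2) * wMean (p k) (fun a => X k a ^ 2)
  have key : ∀ j l, B i k * B j l * prodExpect p (fun ω =>
      X i (ω i) * X k (ω k) * (X j (ω j) * X l (ω l))) =
      (if j = i then if l = k then B i k ^ 2 * s else 0 else 0) +
      (if j = k then if l = i then B i k ^ 2 * s else 0 else 0) := by
    intro j l
    by_cases hjl : j = l
    · subst hjl
      rw [hB0, mul_zero, zero_mul]
      by_cases h1 : j = i
      · subst h1; simp [hik]
      · simp [h1]
    by_cases h1 : i = j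
    · subst h1
      by_cases h2 : k = l
      · subst h2
        have : (fun ω : ∀ i, Ω i => X i (ω i) * X k (ω k) * (X i (ω i) * X k (ω k))) =
          fun ω => X i (ω i) ^ 2 * X k (ω k) ^ 2 := by funext ω; ring
        rw [this, prodExpect_sq_mul_sq hp hik]
        simp only [if_true, hik, if_false, s]
        ring
      · have : (fun ω : ∀ i, Ω i => X i (ω i) * X k (ω k) * (X i (ω i) * X l (ω l))) =
          -- Here `k` is the unrepeated index, so it is moved to the front.
          fun ω => X k (ω k) * X i (ω i) * (X i (ω i) * X l (ω l)) := by funext ω; ring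
        rw [this, prodExpect_four_eq_zero hX (Ne.symm hik) (Ne.symm hik) h2]
        simp [hik, Ne.symm h2]
    · by_cases h2 : i = l
      · subst h2
        by_cases h3 : k = j
        · subst h3
          have : (fun ω : ∀ i, Ω i => X i (ω i) * X k (ω k) * (X k (ω k) * X i (ω i))) =
            fun ω => X i (ω i) ^ 2 * X k (ω k) ^ 2 := by funext ω; ring
          rw [this, prodExpect_sq_mul_sq hp hik, hB k i]
          simp only [if_true, Ne.symm hik, if_false, s]
          ring
        · have : (fun ω : ∀ i, Ω i => X i (ω i) * X k (ω k) * (X j (ω j) * X i (ω i))) =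
            fun ω => X k (ω k) * X i (ω i) * (X j (ω j) * X i (ω i)) := by funext ω; ring
          rw [this, prodExpect_four_eq_zero hX (Ne.symm hik) h3 (Ne.symm hik)]
          simp [Ne.symm h1, Ne.symm h3]
      · rw [prodExpect_four_eq_zero hX hik h1 h2]
        simp [Ne.symm h1, Ne.symm h2]
  simp only [key, Finset.sum_add_distrib]
  simp
  ring

end ProductExpectation

/-! ### Studentized sums of independent variables -/

section Studentized

/-- The properties of the coefficients of the quadratic form in the variance estimator. -/
structure IsVarForm {ι : Type*} [Fintype ι] (B : ι → ι → ℝ) (C : ℝ) : Prop where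
  symm : ∀ i k, B i k = B k i
  diag : ∀ i, B i i = 1
  row : ∀ i, ∑ k, B i k ^ 2 ≤ C
  nonneg : ∀ m : ι → ℝ, 0 ≤ ∑ i, (∑ k, B i k * m k) * m i
  le : ∀ m : ι → ℝ, ∑ i, (∑ k, B i k * m k) * m i ≤ C * ∑ i, m i ^ 2
  mulVec : ∀ m : ι → ℝ, ∑ i, (∑ k, B i k * m k) ^ 2 ≤ C * ∑ i, (∑ k, B i k * m k) * m i

/-- The unit diagonal isolates `∑ X_i²`, and symmetry merges the two cross terms. -/
lemma quadForm_add {ι : Type*} [Fintype ι] [DecidableEq ι] {B : ι → ι → ℝ} {C : ℝ}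
    (hB : IsVarForm B C) (X m x : ι → ℝ) (hx : ∀ i, x i = X i + m i) :
    ∑ i, (∑ k, B i k * x k) * x i =
      ∑ i, ∑ k, (if i = k then 0 else B i k) * (X i * X k) + ∑ i, X i ^ 2 +
        2 * ∑ i, (∑ k, B i k * m k) * X i + ∑ i, (∑ k, B i k * m k) * m i := by
  have e1 : ∑ i, ∑ k, (if i = k then 0 else B i k) * (X i * X k) + ∑ i, X i ^ 2 =
      ∑ i, (∑ k, B i k * X k) * X i := by
    rw [← Finset.sum_add_distrib]
    refine Finset.sum_congr rfl fun i _ => ?_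
    have e3 : X i ^ 2 = ∑ k, if i = k then X i * X k else 0 := by simp [sq]
    rw [e3, ← Finset.sum_add_distrib, Finset.sum_mul]
    refine Finset.sum_congr rfl fun k _ => ?_
    split_ifs with hik
    · subst hik; rw [hB.diag]; ring
    · ring
  have e2 : ∑ i, (∑ k, B i k * m k) * X i = ∑ i, (∑ k, B i k * X k) * m i := by
    simp only [Finset.sum_mul]
    rw [Finset.sum_comm]
    refine Finset.sum_congr rfl fun i _ => Finset.sum_congr rfl fun k _ => ?_
    rw [hB.symm i k]; ring
  rw [e1, two_mul]
  nth_rewrite 1 [e2]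
  simp only [← Finset.sum_add_distrib]
  refine Finset.sum_congr rfl fun i _ => ?_
  simp only [hx, mul_add, Finset.sum_add_distrib]
  ring

/-- Here `s` is the variance estimate, `T` the centred sum, `-k` the total mean and `K` the
inflation of `s` by the means. For `a ≥ 0` only the lower bound on `s` matters. For `a ≤ 0`, `√s ≤ 1
+ 2η + ηk`, and the loss `η|a|k` is at most the gain `k`. -/
lemma studentized_threshold {a b η K k s T : ℝ} (hη0 : 0 < η) (hη : η ≤ 1 / 4)
    (hηa : η * |a| ≤ 1) (hab : 4 * η * |a| ≤ a - b) (hk : 0 ≤ k) (hKk : K ≤ η * k)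
    (hs : 1 - 4 * η ≤ s) (hs' : s ≤ 1 + 4 * η + 2 * K) (hT : a * √s ≤ T - k) : b ≤ T := by
  rcases le_total 0 a with ha | ha
  · rw [abs_of_nonneg ha] at hab
    have h1 : 1 - 4 * η ≤ √s := Real.le_sqrt_of_sq_le (by nlinarith)
    nlinarith
  · rw [abs_of_nonpos ha] at hab hηa
    have h1 : √s ≤ 1 + 2 * η + η * k := by
      rw [Real.sqrt_le_left (by positivity)]
      nlinarith [mul_nonneg hη0.le hk, sq_nonneg (2 * η + η * k)]
    nlinarith

variable {ι : Type*} [Fintype ι] [DecidableEq ι] {Ω : ι → Type*} [∀ i, Fintype (Ω i)]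
  {p : ∀ i, Ω i → ℝ} {B : ι → ι → ℝ} {C : ℝ}

/-- Bounding `v_i v_k` by the mean of `v_i²` and `v_k²` reduces the double sum to row sums of `B²`,
which are at most `C`. -/
lemma prodExpect_offDiag_le (hp : IsWeight p) {X : ∀ i, Ω i → ℝ}
    (hX : ∀ i, wMean (p i) (X i) = 0) (hB : IsVarForm B C) :
    prodExpect p (fun ω => (∑ i, ∑ k, (if i = k then 0 else B i k) *
      (X i (ω i) * X k (ω k))) ^ 2) ≤ 2 * C * ∑ i, wMean (p i) (fun a => X i a ^ 4) := by
  rw [prodExpect_offDiag_sq hp hX (B := fun i k => if i = k then 0 else B i k)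
    (fun i k => by simp only [eq_comm (a := i), hB.symm i k]) (by simp)]
  set v : ι → ℝ := fun i => wMean (p i) (fun a => X i a ^ 2) with hv
  have hv4 : ∀ i, v i ^ 2 ≤ wMean (p i) (fun a => X i a ^ 4) := fun i => by
    have h := sq_wMean_le (p i) (hp.nonneg i) (hp.sum_eq_one i) fun a => X i a ^ 2
    simp only [← pow_mul] at h
    exact h
  have h1 : ∑ i, ∑ k, (if i = k then 0 else B i k) ^ 2 * (v i * v k) ≤
      ∑ i, ∑ k, B i k ^ 2 * ((v i ^ 2 + v k ^ 2) / 2) := by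
    refine Finset.sum_le_sum fun i _ => Finset.sum_le_sum fun k _ => ?_
    have h2 : v i * v k ≤ (v i ^ 2 + v k ^ 2) / 2 := by nlinarith [sq_nonneg (v i - v k)]
    split_ifs
    · simp only [ne_eq, OfNat.ofNat_ne_zero, not_false_eq_true, zero_pow, zero_mul]
      positivity
    · exact mul_le_mul_of_nonneg_left h2 (sq_nonneg _)
  have h2 : ∑ i, ∑ k, B i k ^ 2 * ((v i ^ 2 + v k ^ 2) / 2) = ∑ i, (∑ k, B i k ^ 2) * v i ^ 2 := by
    have h3 : ∑ i, ∑ k, B i k ^ 2 * v k ^ 2 = ∑ i, ∑ k, B i k ^ 2 * v i ^ 2 := by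
      rw [Finset.sum_comm]
      exact Finset.sum_congr rfl fun i _ => Finset.sum_congr rfl fun k _ => by rw [hB.symm]
    have h4 : ∀ i k, B i k ^ 2 * ((v i ^ 2 + v k ^ 2) / 2) =
      (B i k ^ 2 * v i ^ 2 + B i k ^ 2 * v k ^ 2) / 2 := fun i k => by ring
    simp only [h4, ← Finset.sum_div, Finset.sum_add_distrib, h3, Finset.sum_mul]
    ring
  have h3 : ∑ i, (∑ k, B i k ^ 2) * v i ^ 2 ≤ C * ∑ i, wMean (p i) (fun a => X i a ^ 4) := by
    rw [Finset.mul_sum]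
    refine Finset.sum_le_sum fun i _ => ?_
    have h4 : 0 ≤ C := (Finset.sum_nonneg fun k _ => sq_nonneg _).trans (hB.row i)
    exact mul_le_mul (hB.row i) (hv4 i) (sq_nonneg _) h4
  linarith

lemma prodExpect_sum_sq_sub_le (hp : IsWeight p) (X : ∀ i, Ω i → ℝ) :
    prodExpect p (fun ω => (∑ i, X i (ω i) ^ 2 - ∑ i, wMean (p i) (fun a => X i a ^ 2)) ^ 2) ≤
      ∑ i, wMean (p i) (fun a => X i a ^ 4) := by
  simp only [← Finset.sum_sub_distrib]
  rw [prodExpect_sum_sq hp (X := fun i a => X i a ^ 2 - wMean (p i) (fun a => X i a ^ 2))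
    fun i => by rw [wMean_sub, wMean_const _ (hp.sum_eq_one i), sub_self]]
  refine Finset.sum_le_sum fun i _ => ?_
  rw [wMean_sub_const_sq _ (hp.sum_eq_one i)]
  simp only [← pow_mul]
  nlinarith [sq_nonneg (wMean (p i) fun a => X i a ^ 2)]

/-- A studentized sum of independent variables with nonpositive means exceeds `a` with at most the
probability that the standardized sum exceeds `b < a`, up to an error controlled by the fourth
moments. -/
theorem prodProb_studentized_le (hp : IsWeight p) {x : ∀ i, Ω i → ℝ}
    (hm : ∀ i, wMean (p i) (x i) ≤ 0)
    (hvar : ∑ i, wMean (p i) (fun a => (x i a - wMean (p i) (x i)) ^ 2) = 1)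
    (hB : IsVarForm B C) (hC : 0 ≤ C) {a b η e : ℝ} (hη0 : 0 < η) (hη : η ≤ 1 / 8)
    (hηa : η * |a| ≤ 1) (hab : 4 * η * |a| ≤ a - b) (he : 0 ≤ e)
    (hx : ∑ i, wMean (p i) (fun a => x i a ^ 4) ≤ e ^ 4) (hCe : C * e ≤ η) :
    prodProb p {ω | a ≤ (∑ i, x i (ω i)) / √(∑ i, (∑ k, B i k * x k (ω k)) * x i (ω i))} ≤
      prodProb p {ω | b ≤ ∑ i, (x i (ω i) - wMean (p i) (x i))} +
        (32 * C * e ^ 4 + 16 * e ^ 4 + 4 * C * e ^ 2) / η ^ 2 := by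
  set m : ι → ℝ := fun i => wMean (p i) (x i) with hmdef
  set X : ∀ i, Ω i → ℝ := fun i a => x i a - m i with hXdef
  have hX : ∀ i, wMean (p i) (X i) = 0 := fun i => by
    rw [hXdef, wMean_sub, wMean_const _ (hp.sum_eq_one i), sub_self]
  have hx0 : ∀ i, 0 ≤ wMean (p i) (fun a => x i a ^ 4) := fun i =>
    wMean_nonneg _ (hp.nonneg i) fun _ => by positivity
  have hxi : ∀ i, wMean (p i) (fun a => x i a ^ 4) ≤ e ^ 4 := fun i =>
    (Finset.single_le_sum (fun i _ => hx0 i) (Finset.mem_univ i)).trans hx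
  have hX4 : ∀ i, wMean (p i) (fun a => X i a ^ 4) ≤ 16 * wMean (p i) (fun a => x i a ^ 4) :=
    fun i => wMean_centered_pow_four_le _ (hp.nonneg i) (hp.sum_eq_one i) _
  have hXs : ∑ i, wMean (p i) (fun a => X i a ^ 4) ≤ 16 * e ^ 4 := by
    refine (Finset.sum_le_sum fun i _ => hX4 i).trans ?_
    rw [← Finset.mul_sum]
    linarith
  have hme : ∀ i, -m i ≤ e := fun i => by
    refine le_of_pow_le_pow_left₀ (n := 4) (by norm_num) he ?_
    rw [Even.neg_pow (by decide)]
    exact (wMean_pow_four_le _ (hp.nonneg i) (hp.sum_eq_one i) _).trans (hxi i)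
  have hv : ∀ i, wMean (p i) (fun a => X i a ^ 2) ≤ 4 * e ^ 2 := fun i => by
    refine le_of_pow_le_pow_left₀ (n := 2) (by norm_num) (by positivity) ?_
    have h := sq_wMean_le (p i) (hp.nonneg i) (hp.sum_eq_one i) fun a => X i a ^ 2
    simp only [← pow_mul] at h
    refine h.trans ((hX4 i).trans ?_)
    have := hxi i
    nlinarith
  set K := ∑ i, (∑ k, B i k * m k) * m i with hK
  have hK0 : 0 ≤ K := hB.nonneg m
  set κ := ∑ i, -m i with hκ
  have hκ0 : 0 ≤ κ := Finset.sum_nonneg fun i _ => neg_nonneg.2 (hm i)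
  -- Each `|m_i|` is at most `e`, so `∑ m_i² ≤ e κ`: the inflation is small next to the downward
  -- drift.
  have hKκ : K ≤ η * κ := by
    have h1 : ∑ i, m i ^ 2 ≤ e * κ := by
      rw [hκ, Finset.mul_sum]
      refine Finset.sum_le_sum fun i _ => ?_
      have h1 := hme i
      have h2 : m i ≤ 0 := hm i
      nlinarith
    calc K ≤ C * ∑ i, m i ^ 2 := hB.le m
      _ ≤ C * (e * κ) := mul_le_mul_of_nonneg_left h1 hC
      _ = C * e * κ := by ring
      _ ≤ η * κ := mul_le_mul_of_nonneg_right hCe hκ0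
  let off : (∀ i, Ω i) → ℝ := fun ω =>
    ∑ i, ∑ k, (if i = k then 0 else B i k) * (X i (ω i) * X k (ω k))
  let dg : (∀ i, Ω i) → ℝ := fun ω =>
    ∑ i, X i (ω i) ^ 2 - ∑ i, wMean (p i) (fun a => X i a ^ 2)
  let lin : (∀ i, Ω i) → ℝ := fun ω => ∑ i, (∑ k, B i k * m k) * X i (ω i)
  have hoff : prodProb p {ω | η ^ 2 < off ω ^ 2} ≤ 32 * C * e ^ 4 / η ^ 2 := by
    rw [le_div_iff₀' (by positivity)]
    refine (mul_prodProb_le hp (fun ω => sq_nonneg (off ω)) _).trans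
      ((prodExpect_offDiag_le hp hX hB).trans ?_)
    nlinarith
  have hdg : prodProb p {ω | η ^ 2 < dg ω ^ 2} ≤ 16 * e ^ 4 / η ^ 2 := by
    rw [le_div_iff₀' (by positivity)]
    exact (mul_prodProb_le hp (fun ω => sq_nonneg (dg ω)) _).trans
      ((prodExpect_sum_sq_sub_le hp X).trans hXs)
  -- `K` need not be bounded, so the cross term is compared with `K + 1`; its second moment is of
  -- order `e² K`, and `K / (K + 1) ≤ 1`.
  have hlin : prodProb p {ω | η ^ 2 * (K + 1) < lin ω ^ 2} ≤ 4 * C * e ^ 2 / η ^ 2 := by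
    have h1 : prodExpect p (fun ω => lin ω ^ 2) ≤ 4 * C * e ^ 2 * K := by
      rw [prodExpect_sum_sq hp (X := fun i a => (∑ k, B i k * m k) * X i a)
        fun i => by rw [wMean_const_mul, hX, mul_zero]]
      simp only [mul_pow, wMean_const_mul]
      calc _ ≤ ∑ i, (∑ k, B i k * m k) ^ 2 * (4 * e ^ 2) :=
            Finset.sum_le_sum fun i _ => mul_le_mul_of_nonneg_left (hv i) (sq_nonneg _)
        _ = (∑ i, (∑ k, B i k * m k) ^ 2) * (4 * e ^ 2) := by rw [Finset.sum_mul]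
        _ ≤ C * K * (4 * e ^ 2) := mul_le_mul_of_nonneg_right (hB.mulVec m) (by positivity)
        _ = _ := by ring
    have h2 := (mul_prodProb_le hp (fun ω => sq_nonneg (lin ω)) (η ^ 2 * (K + 1))).trans h1
    rw [le_div_iff₀' (by positivity)]
    have h3 : 0 ≤ 4 * C * e ^ 2 := by positivity
    have h4 : 0 < K + 1 := by positivity
    refine le_of_mul_le_mul_right ?_ h4
    nlinarith
  have hsub : {ω | a ≤ (∑ i, x i (ω i)) / √(∑ i, (∑ k, B i k * x k (ω k)) * x i (ω i))} ⊆
      {ω | b ≤ ∑ i, X i (ω i)} ∪ ({ω | η ^ 2 < off ω ^ 2} ∪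
        ({ω | η ^ 2 < dg ω ^ 2} ∪ {ω | η ^ 2 * (K + 1) < lin ω ^ 2})) := by
    intro ω hω
    by_contra hn
    simp only [Set.mem_union, Set.mem_ofPred_eq, not_or, not_lt] at hn hω
    obtain ⟨hn1, hn2, hn3, hn4⟩ := hn
    apply hn1
    have hS : ∑ i, (∑ k, B i k * x k (ω k)) * x i (ω i) =
        off ω + (dg ω + 1) + 2 * lin ω + K := by
      have e1 : dg ω + 1 = ∑ i, X i (ω i) ^ 2 := by
        simp only [dg]; rw [hvar]; ring
      rw [e1]
      exact quadForm_add hB _ m _ fun i => by simp [hXdef]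
    have b1 := abs_le_of_sq_le_sq' hn2 hη0.le
    have b2 := abs_le_of_sq_le_sq' hn3 hη0.le
    -- `K + 1 ≤ (K / 2 + 1)²` makes the cross term linear in `K`, so the term `K ≥ 0` of the
    -- expansion absorbs it.
    have b3 : lin ω ^ 2 ≤ (η * (K / 2 + 1)) ^ 2 := hn4.trans (by
      rw [mul_pow]
      exact mul_le_mul_of_nonneg_left (by nlinarith) (sq_nonneg _))
    have b4 := abs_le_of_sq_le_sq' b3 (by positivity)
    rw [mul_add, mul_one, neg_add] at b4
    have b5 : η * (K / 2) ≤ K / 8 := by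
      have := mul_le_mul_of_nonneg_right hη hK0
      linarith
    clear_value off dg lin K κ
    have b6 : 1 - 4 * η ≤ ∑ i, (∑ k, B i k * x k (ω k)) * x i (ω i) := by rw [hS]; linarith
    refine studentized_threshold hη0 (by linarith) hηa hab hκ0 hKκ b6 ?_ ?_
    · rw [hS]; linarith
    -- The estimate is at least `1 - 4η > 0` here, so a zero denominator can occur only on the
    -- exceptional events.
    · refine ((le_div_iff₀ (Real.sqrt_pos.2 (by linarith))).1 hω).trans (le_of_eq ?_)
      simp [hXdef, hκ]
  refine (prodProb_mono hp hsub).trans ((prodProb_union_le hp _ _).trans ?_)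
  have h1 := prodProb_union_le hp {ω | η ^ 2 < off ω ^ 2}
        ({ω | η ^ 2 < dg ω ^ 2} ∪ {ω | η ^ 2 * (K + 1) < lin ω ^ 2})
  have h2 := prodProb_union_le hp {ω | η ^ 2 < dg ω ^ 2} {ω | η ^ 2 * (K + 1) < lin ω ^ 2}
  rw [add_div, add_div]
  linarith

end Studentized

/-! ### A central limit theorem for triangular arrays -/

section CentralLimit

open MeasureTheory ProbabilityTheory

/-- Replace the factors one at a time; all the others have norm at most one. -/
lemma norm_prod_sub_prod_le {ι : Type*} (s : Finset ι) (a b : ι → ℂ) (ha : ∀ i, ‖a i‖ ≤ 1)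
    (hb : ∀ i, ‖b i‖ ≤ 1) : ‖∏ i ∈ s, a i - ∏ i ∈ s, b i‖ ≤ ∑ i ∈ s, ‖a i - b i‖ := by
  classical
  induction s using Finset.induction_on with
  | empty => simp
  | insert i s his ih =>
    rw [Finset.prod_insert his, Finset.prod_insert his, Finset.sum_insert his]
    have hbs : ‖∏ i ∈ s, b i‖ ≤ 1 := by
      rw [norm_prod]
      exact Finset.prod_le_one (fun _ _ => norm_nonneg _) fun i _ => hb i
    calc ‖a i * ∏ i ∈ s, a i - b i * ∏ i ∈ s, b i‖
        = ‖a i * (∏ i ∈ s, a i - ∏ i ∈ s, b i) + (a i - b i) * ∏ i ∈ s, b i‖ := by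
          congr 1; ring
      _ ≤ ‖a i‖ * ‖∏ i ∈ s, a i - ∏ i ∈ s, b i‖ + ‖a i - b i‖ * ‖∏ i ∈ s, b i‖ := by
          refine (norm_add_le _ _).trans (le_of_eq ?_)
          rw [norm_mul, norm_mul]
      _ ≤ 1 * ‖∏ i ∈ s, a i - ∏ i ∈ s, b i‖ + ‖a i - b i‖ * 1 := by
          gcongr
          exact ha i
      _ ≤ _ := by linarith

lemma norm_cexp_mul_I_sub_le (y : ℝ) :
    ‖Complex.exp (y * Complex.I) - (1 + y * Complex.I - y ^ 2 / 2)‖ ≤ 4 * |y| ^ 3 := by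
  have hI : ‖(y : ℂ) * Complex.I‖ = |y| := by simp
  rcases le_total |y| 1 with h | h
  · have h1 := Complex.exp_bound (x := y * Complex.I) (by rw [hI]; exact h) (n := 3) (by norm_num)
    simp only [Finset.sum_range_succ, Finset.sum_range_zero, hI, mul_pow, Complex.I_sq] at h1
    norm_num [Nat.factorial] at h1
    have h2 : (1 : ℂ) + y * Complex.I - y ^ 2 / 2 = 1 + y * Complex.I + -(y : ℂ) ^ 2 / 2 := by ring
    rw [h2]
    exact h1.trans (by nlinarith [pow_nonneg (abs_nonneg y) 3])
  · have h2 : ‖(1 : ℂ) + y * Complex.I - y ^ 2 / 2‖ ≤ 1 + |y| + |y| ^ 2 / 2 := by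
      refine (norm_sub_le _ _).trans (add_le_add ((norm_add_le _ _).trans (le_of_eq ?_)) (le_of_eq ?_))
      · simp
      · simp
    have h3 := (norm_sub_le (Complex.exp (y * Complex.I)) (1 + y * Complex.I - y ^ 2 / 2))
    rw [Complex.norm_exp_ofReal_mul_I] at h3
    have h4 : |y| ^ 2 ≤ |y| ^ 3 := pow_le_pow_right₀ h (by norm_num)
    have h5 : |y| ≤ |y| ^ 3 := le_self_pow₀ h (by norm_num)
    linarith

lemma abs_exp_neg_sub_le {v : ℝ} (hv : 0 ≤ v) : |Real.exp (-v) - (1 - v)| ≤ v ^ 2 := by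
  have h1 := Real.one_sub_le_exp_neg v
  rw [abs_of_nonneg (by linarith)]
  rcases le_total v 1 with h | h
  · have h2 : Real.exp (-v) * (1 + v) ≤ 1 := by
      have h3 : Real.exp (-v) * Real.exp v = 1 := by rw [← Real.exp_add]; simp
      have h4 := Real.add_one_le_exp v
      nlinarith [Real.exp_pos (-v)]
    have h3 : Real.exp (-v) ≤ 1 := Real.exp_le_one_iff.2 (by linarith)
    nlinarith
  · have h3 : Real.exp (-v) ≤ 1 := Real.exp_le_one_iff.2 (by linarith)
    nlinarith

/-- The characteristic function of a finitely supported centred variable. -/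
lemma norm_charSum_sub_le {A : Type*} [Fintype A] {p : A → ℝ} (h0 : ∀ a, 0 ≤ p a)
    (h1 : ∑ a, p a = 1) {X : A → ℝ} (hX : wMean p X = 0) (t : ℝ) {η : ℝ} (hη : 0 < η) :
    ‖∑ a, (p a : ℂ) * Complex.exp (t * X a * Complex.I) -
      (Real.exp (-(t ^ 2 * wMean p (fun a => X a ^ 2) / 2)) : ℝ)‖ ≤
      2 * |t| ^ 3 * (η * wMean p (fun a => X a ^ 2) + wMean p (fun a => X a ^ 4) / η) +
        t ^ 4 * wMean p (fun a => X a ^ 4) := by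
  set v := wMean p (fun a => X a ^ 2) with hv
  have hv0 : 0 ≤ v := wMean_nonneg _ h0 fun _ => sq_nonneg _
  have hv4 : v ^ 2 ≤ wMean p (fun a => X a ^ 4) := by
    have h := sq_wMean_le p h0 h1 fun a => X a ^ 2
    simp only [← pow_mul] at h
    exact h
  have e1 : ((1 - t ^ 2 * v / 2 : ℝ) : ℂ) =
      ∑ a, (p a : ℂ) * (1 + (t * X a : ℝ) * Complex.I - (t * X a : ℝ) ^ 2 / 2) := by
    have e : ∀ a, (p a : ℂ) * (1 + (t * X a : ℝ) * Complex.I - (t * X a : ℝ) ^ 2 / 2) =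
        ((p a : ℝ) : ℂ) + t * Complex.I * ((p a * X a : ℝ) : ℂ) -
          t ^ 2 / 2 * ((p a * X a ^ 2 : ℝ) : ℂ) := fun a => by
      push_cast; ring
    simp only [e, Finset.sum_add_distrib, Finset.sum_sub_distrib, ← Finset.mul_sum,
      ← Complex.ofReal_sum]
    have hX' : ∑ a, p a * X a = 0 := hX
    have hv' : ∑ a, p a * X a ^ 2 = v := rfl
    rw [h1, hX', hv']
    push_cast; ring
  have b1 : ‖∑ a, (p a : ℂ) * Complex.exp (t * X a * Complex.I) - ((1 - t ^ 2 * v / 2 : ℝ) : ℂ)‖ ≤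
      2 * |t| ^ 3 * (η * v + wMean p (fun a => X a ^ 4) / η) := by
    rw [e1, ← Finset.sum_sub_distrib]
    have : ∀ a, ‖(p a : ℂ) * Complex.exp (t * X a * Complex.I) -
        (p a : ℂ) * (1 + (t * X a : ℝ) * Complex.I - (t * X a : ℝ) ^ 2 / 2)‖ ≤
        p a * (2 * |t| ^ 3 * (η * X a ^ 2 + X a ^ 4 / η)) := fun a => by
      rw [← mul_sub, norm_mul, Complex.norm_real, Real.norm_of_nonneg (h0 a)]
      refine mul_le_mul_of_nonneg_left ?_ (h0 a)
      have h2 := norm_cexp_mul_I_sub_le (t * X a)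
      rw [abs_mul, mul_pow] at h2
      -- AM-GM trades the third absolute moment for the second and fourth, the only ones under
      -- control.
      have h3 : 2 * |X a| ^ 3 ≤ η * X a ^ 2 + X a ^ 4 / η := by
        have h4 : 2 * |X a| ^ 3 * η ≤ η ^ 2 * |X a| ^ 2 + |X a| ^ 4 := by
          nlinarith [sq_nonneg (|X a| * (η - |X a|))]
        rw [← sq_abs (X a), ← Even.pow_abs (n := 4) (by decide) (X a)]
        have h5 : η * |X a| ^ 2 + |X a| ^ 4 / η = (η ^ 2 * |X a| ^ 2 + |X a| ^ 4) / η := by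
          field_simp
        rw [h5, le_div_iff₀ hη]
        exact h4
      push_cast at h2 ⊢
      refine h2.trans ?_
      have h4 : 0 ≤ |t| ^ 3 := by positivity
      nlinarith
    refine (norm_sum_le _ _).trans ((Finset.sum_le_sum fun a _ => this a).trans (le_of_eq ?_))
    change wMean p (fun a => 2 * |t| ^ 3 * (η * X a ^ 2 + X a ^ 4 / η)) = _
    simp only [wMean_const_mul, wMean_add, div_eq_inv_mul, hv]
  have b2 : ‖((1 - t ^ 2 * v / 2 : ℝ) : ℂ) - (Real.exp (-(t ^ 2 * v / 2)) : ℝ)‖ ≤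
      t ^ 4 * wMean p (fun a => X a ^ 4) := by
    rw [← Complex.ofReal_sub, Complex.norm_real, Real.norm_eq_abs, abs_sub_comm]
    refine (abs_exp_neg_sub_le (by positivity)).trans ?_
    have h4 : 0 ≤ t ^ 4 := by positivity
    nlinarith [mul_le_mul_of_nonneg_left hv4 h4, mul_nonneg h4 (sq_nonneg v)]
  exact (norm_sub_le_norm_sub_add_norm_sub _ _ _).trans (add_le_add b1 b2)

/-! ### Laws of sums and their characteristic functions. -/

section Law

variable {ι : Type*} [Fintype ι] [DecidableEq ι] {Ω : ι → Type*} [∀ i, Fintype (Ω i)]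
  {p : ∀ i, Ω i → ℝ}

/-- The law of `f` under the product of the weights `p i`. -/
def prodLaw (p : ∀ i, Ω i → ℝ) (f : (∀ i, Ω i) → ℝ) : Measure ℝ :=
  ∑ ω, ENNReal.ofReal (∏ i, p i (ω i)) • Measure.dirac (f ω)

lemma prodLaw_apply (hp : IsWeight p) (f : (∀ i, Ω i) → ℝ) {A : Set ℝ} (hA : MeasurableSet A) :
    prodLaw p f A = ENNReal.ofReal (prodProb p (f ⁻¹' A)) := by
  rw [prodLaw, Measure.finsetSum_apply, prodProb, prodExpect, ENNReal.ofReal_sum_of_nonneg]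
  · refine Finset.sum_congr rfl fun ω _ => ?_
    rw [Measure.smul_apply, Measure.dirac_apply' _ hA, smul_eq_mul]
    by_cases h : f ω ∈ A <;> simp [h]
  · exact fun ω _ => mul_nonneg (Finset.prod_nonneg fun i _ => hp.nonneg i _)
      (Set.indicator_nonneg (fun _ _ => zero_le_one) ω)

lemma isProbabilityMeasure_prodLaw (hp : IsWeight p) (f : (∀ i, Ω i) → ℝ) :
    IsProbabilityMeasure (prodLaw p f) := by
  refine ⟨?_⟩
  rw [prodLaw_apply hp f MeasurableSet.univ, Set.preimage_univ, prodProb, Set.indicator_univ,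
    prodExpect_const hp, ENNReal.ofReal_one]

lemma charFun_prodLaw_sum (hp : IsWeight p) (X : ∀ i, Ω i → ℝ) (t : ℝ) :
    charFun (prodLaw p fun ω => ∑ i, X i (ω i)) t =
      ∏ i, ∑ a, (p i a : ℂ) * Complex.exp (t * X i a * Complex.I) := by
  rw [charFun_apply_real, prodLaw, integral_finsetSum_measure, ← sum_prod_mul_prod]
  · refine Finset.sum_congr rfl fun ω _ => ?_
    rw [integral_smul_measure, integral_dirac,
      ENNReal.toReal_ofReal (Finset.prod_nonneg fun i _ => hp.nonneg i _), ← Complex.exp_sum,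
      Complex.real_smul]
    push_cast
    simp only [Finset.mul_sum, Finset.sum_mul]
  · intro ω _
    exact (integrable_dirac (by simp)).smul_measure ENNReal.ofReal_ne_top

end Law

/-- Lyapunov's central limit theorem, with fourth moments, for a triangular array of independent
finitely supported variables. -/
theorem tendsto_prodProb_of_lyapunov {ι : ℕ → Type*} [∀ n, Fintype (ι n)] [∀ n, DecidableEq (ι n)]
    {Ω : ∀ n, ι n → Type*} [∀ n i, Fintype (Ω n i)] {p : ∀ n i, Ω n i → ℝ}
    (hp : ∀ n, IsWeight (p n)) {X : ∀ n i, Ω n i → ℝ} (hX : ∀ n i, wMean (p n i) (X n i) = 0)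
    (hvar : ∀ᶠ n in atTop, ∑ i, wMean (p n i) (fun a => X n i a ^ 2) = 1)
    (h4 : Tendsto (fun n => ∑ i, wMean (p n i) (fun a => X n i a ^ 4)) atTop (𝓝 0)) (b : ℝ) :
    Tendsto (fun n => prodProb (p n) {ω | b ≤ ∑ i, X n i (ω i)}) atTop
      (𝓝 (1 - cdf (gaussianReal 0 1) b)) := by
  let μ : ℕ → ProbabilityMeasure ℝ := fun n =>
    ⟨prodLaw (p n) fun ω => ∑ i, X n i (ω i), isProbabilityMeasure_prodLaw (hp n) _⟩
  let ν : ProbabilityMeasure ℝ := ⟨gaussianReal 0 1, inferInstance⟩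
  have hlim : Tendsto μ atTop (𝓝 ν) := by
    refine ProbabilityMeasure.tendsto_of_tendsto_charFun fun t => ?_
    have hν : charFun (ν : Measure ℝ) t = (Real.exp (-(t ^ 2 / 2)) : ℝ) := by
      change charFun (gaussianReal 0 1) t = _
      rw [charFun_gaussianReal]
      push_cast
      simp
    rw [hν, Metric.tendsto_atTop']
    intro ε hε
    -- The variances sum to one, so the second-moment error totals `2|t|³η`; with `η` fixed, the
    -- rest tends to zero with the fourth moments.
    obtain ⟨η, hη, hη'⟩ : ∃ η : ℝ, 0 < η ∧ 2 * |t| ^ 3 * η < ε / 2 := by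
      refine ⟨ε / 2 / (2 * |t| ^ 3 + 1), by positivity, ?_⟩
      rw [← mul_div_assoc, div_lt_iff₀ (by positivity)]
      nlinarith
    have h5 : Tendsto (fun n => (2 * |t| ^ 3 / η + t ^ 4) *
        ∑ i, wMean (p n i) (fun a => X n i a ^ 4)) atTop (𝓝 0) := by
      simpa using h4.const_mul (2 * |t| ^ 3 / η + t ^ 4)
    have h6 := h5.eventually (gt_mem_nhds (half_pos hε))
    obtain ⟨N, hN⟩ := eventually_atTop.1 (hvar.and h6)
    refine ⟨N, fun n hn => ?_⟩
    obtain ⟨hv, hM⟩ := hN n hn.le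
    have hexp : ((Real.exp (-(t ^ 2 / 2)) : ℝ) : ℂ) =
        ∏ i, ((Real.exp (-(t ^ 2 * wMean (p n i) (fun a => X n i a ^ 2) / 2)) : ℝ) : ℂ) := by
      rw [← Complex.ofReal_prod, ← Real.exp_sum, Finset.sum_neg_distrib, ← Finset.sum_div,
        ← Finset.mul_sum, hv, mul_one]
    have hchar : charFun (μ n : Measure ℝ) t =
        ∏ i, ∑ a, (p n i a : ℂ) * Complex.exp (t * X n i a * Complex.I) :=
      charFun_prodLaw_sum (hp n) (X n) t
    rw [dist_eq_norm, hchar, hexp]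
    refine (norm_prod_sub_prod_le _ _ _ (fun i => ?_) fun i => ?_).trans_lt ?_
    · refine (norm_sum_le _ _).trans (le_of_eq ?_)
      rw [← (hp n).sum_eq_one i]
      refine Finset.sum_congr rfl fun a _ => ?_
      rw [norm_mul, ← Complex.ofReal_mul, Complex.norm_exp_ofReal_mul_I, mul_one,
        Complex.norm_real, Real.norm_of_nonneg ((hp n).nonneg i a)]
    · rw [Complex.norm_real, Real.norm_of_nonneg (Real.exp_pos _).le, Real.exp_le_one_iff]
      have := wMean_nonneg (p n i) ((hp n).nonneg i) (f := fun a => X n i a ^ 2)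
        fun _ => sq_nonneg _
      have : 0 ≤ t ^ 2 * wMean (p n i) (fun a => X n i a ^ 2) / 2 := by positivity
      linarith
    · refine (Finset.sum_le_sum fun i _ => norm_charSum_sub_le ((hp n).nonneg i)
        ((hp n).sum_eq_one i) (hX n i) t hη).trans_lt ?_
      rw [Finset.sum_add_distrib, ← Finset.mul_sum, ← Finset.mul_sum, Finset.sum_add_distrib,
        ← Finset.mul_sum, ← Finset.sum_div, hv]
      have e : ∀ M : ℝ, 2 * |t| ^ 3 * (η * 1 + M / η) + t ^ 4 * M =
        2 * |t| ^ 3 * η + (2 * |t| ^ 3 / η + t ^ 4) * M := fun M => by ring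
      rw [e]
      linarith
  have hnull : (ν : Measure ℝ) (frontier (Set.Ici b)) = 0 := by
    rw [frontier_Ici]
    change gaussianReal 0 1 {b} = 0
    have := nullSingletonClass_gaussianReal (μ := 0) (v := 1) one_ne_zero
    exact measure_singleton b
  have h := ProbabilityMeasure.tendsto_measure_of_null_frontier_of_tendsto' hlim hnull
  have h' := (ENNReal.tendsto_toReal (measure_ne_top _ _)).comp h
  have hν : ((ν : Measure ℝ) (Set.Ici b)).toReal = 1 - cdf (gaussianReal 0 1) b := by
    change (gaussianReal 0 1).real (Set.Ici b) = _
    have := nullSingletonClass_gaussianReal (μ := 0) (v := 1) one_ne_zero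
    rw [cdf_eq_real, ← probReal_compl_eq_one_sub measurableSet_Iic, Set.compl_Iic]
    exact measureReal_congr Ioi_ae_eq_Ici.symm
  rw [hν] at h'
  refine h'.congr fun n => ?_
  change (prodLaw (p n) (fun ω => ∑ i, X n i (ω i)) (Set.Ici b)).toReal = _
  rw [prodLaw_apply (hp n) _ measurableSet_Ici, ENNReal.toReal_ofReal (prodProb_nonneg (hp n) _)]
  rfl

/-- The jump of a distribution function at `x` is the mass of `{x}`, and the Gaussian has no atoms.
-/
lemma continuous_cdf_gaussianReal : Continuous (cdf (gaussianReal 0 1)) := by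
  have := nullSingletonClass_gaussianReal (μ := 0) (v := 1) one_ne_zero
  refine continuous_iff_continuousAt.2 fun x => ?_
  have h : (cdf (gaussianReal 0 1)).measure {x} = 0 := by
    rw [measure_cdf]; exact measure_singleton x
  rw [StieltjesFunction.measure_singleton, ENNReal.ofReal_eq_zero, sub_nonpos] at h
  have hl : Function.leftLim (cdf (gaussianReal 0 1)) x = cdf (gaussianReal 0 1) x :=
    le_antisymm ((monotone_cdf _).leftLim_le le_rfl) h
  rw [continuousAt_iff_continuous_left_right, ← continuousWithinAt_Iio_iff_Iic]
  exact ⟨(monotone_cdf _).continuousWithinAt_Iio_iff_leftLim_eq.2 hl,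
    (cdf (gaussianReal 0 1)).right_continuous x⟩

lemma exists_cdf_gaussianReal_eq {y : ℝ} (hy : y ∈ Set.Ioo (0 : ℝ) 1) :
    ∃ x, cdf (gaussianReal 0 1) x = y :=
  mem_range_of_exists_le_of_exists_ge continuous_cdf_gaussianReal
    (((tendsto_cdf_atBot (gaussianReal 0 1)).eventually (gt_mem_nhds hy.1)).exists.imp
      fun _ h => h.le)
    (((tendsto_cdf_atTop (gaussianReal 0 1)).eventually (lt_mem_nhds hy.2)).exists.imp
      fun _ h => h.le)

end CentralLimit

/-! ### The linear program of one matched set -/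

section OneSetBound

variable {n : ℕ} {γ : ℝ} {z u : Fin n → ℝ}

lemma permProb_nonneg (γ : ℝ) (z u : Fin n → ℝ) (π : Equiv.Perm (Fin n)) :
    0 ≤ permProb γ z u π :=
  div_nonneg (Real.exp_pos _).le (Finset.sum_nonneg fun _ _ => (Real.exp_pos _).le)

lemma sum_permProb (γ : ℝ) (z u : Fin n → ℝ) : ∑ π, permProb γ z u π = 1 := by
  simp only [permProb, ← Finset.sum_div]
  exact div_self (Finset.sum_pos (fun _ _ => Real.exp_pos _) Finset.univ_nonempty).ne'

/-- The log-ratio is `γ ∑ (z (π j) - z (π' j)) u j`; over `u ∈ [0,1]` it is extremal when `u`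
selects exactly the negative or exactly the positive differences. -/
lemma permProb_mem_lpFeasible (hγ : 0 ≤ γ) (hu : ∀ j, u j ∈ Set.Icc (0 : ℝ) 1) :
    permProb γ z u ∈ lpFeasible γ z := by
  refine ⟨sum_permProb γ z u, fun π π' => ?_⟩
  have hpos : 0 < ∑ π' : Equiv.Perm (Fin n), Real.exp (γ * ∑ j, z (π' j) * u j) :=
    Finset.sum_pos (fun _ _ => Real.exp_pos _) Finset.univ_nonempty
  have e : permProb γ z u π / permProb γ z u π' =
      Real.exp (γ * ∑ j, (z (π j) - z (π' j)) * u j) := by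
    rw [permProb, permProb, div_div_div_cancel_right₀ hpos.ne', ← Real.exp_sub, ← mul_sub,
      ← Finset.sum_sub_distrib]
    simp only [sub_mul]
  rw [e, Set.mem_Icc, ratioLower, ratioUpper, Real.exp_le_exp, Real.exp_le_exp,
    Finset.sum_filter, Finset.sum_filter]
  constructor <;> refine mul_le_mul_of_nonneg_left (Finset.sum_le_sum fun j _ => ?_) hγ
  · obtain ⟨h0, h1⟩ := hu j
    split_ifs with h
    · nlinarith
    · exact mul_nonneg (by linarith) h0
  · obtain ⟨h0, h1⟩ := hu j
    split_ifs with h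
    · nlinarith
    · nlinarith

/-- Total mass one forces some positive coordinate, and every ratio to it is positive. -/
lemma lpFeasible_nonneg {p : Equiv.Perm (Fin n) → ℝ} (hp : p ∈ lpFeasible γ z)
    (π : Equiv.Perm (Fin n)) : 0 ≤ p π := by
  obtain ⟨π₀, -, h0⟩ : ∃ π₀ ∈ Finset.univ, 0 < p π₀ := by
    refine Finset.exists_lt_of_sum_lt (f := fun _ => (0 : ℝ)) ?_
    rw [hp.1]
    simp
  have h := (Real.exp_pos _).trans_le (hp.2 π π₀).1
  exact ((div_pos_iff_of_pos_right h0).1 h).le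

lemma le_lpOptimum (q₁ q₂ : ℝ → ℝ) (R : Fin n → ℝ) {p : Equiv.Perm (Fin n) → ℝ}
    (hp : p ∈ lpFeasible γ z) :
    ∑ π, p π * setStat q₁ q₂ (fun j => z (π j)) R ≤ lpOptimum γ q₁ q₂ z R := by
  -- A real `sSup` is meaningful only for a set bounded above; feasible weights lie in `[0,1]`,
  -- which gives this bound.
  refine le_csSup ⟨∑ π : Equiv.Perm (Fin n), |setStat q₁ q₂ (fun j => z (π j)) R|, ?_⟩ ⟨p, hp, rfl⟩
  rintro _ ⟨p', hp', rfl⟩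
  refine Finset.sum_le_sum fun π _ => ?_
  have h0 := lpFeasible_nonneg hp' π
  have h1 : p' π ≤ 1 := by
    rw [← hp'.1]
    exact Finset.single_le_sum (fun π _ => lpFeasible_nonneg hp' π) (Finset.mem_univ π)
  calc p' π * setStat q₁ q₂ (fun j => z (π j)) R
      ≤ p' π * |setStat q₁ q₂ (fun j => z (π j)) R| := mul_le_mul_of_nonneg_left (le_abs_self _) h0
    _ ≤ _ := mul_le_of_le_one_left (abs_nonneg _) h1

end OneSetBound

/-! ### The variance estimator as a quadratic form -/

section HatMatrix

variable {I L : ℕ} {Q : Matrix (Fin I) (Fin L) ℝ}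

lemma transpose_hatMatrix (Q : Matrix (Fin I) (Fin L) ℝ) :
    (hatMatrix Q).transpose = hatMatrix Q := by
  simp [hatMatrix, Matrix.transpose_mul, Matrix.transpose_nonsing_inv, Matrix.mul_assoc]

lemma hatMatrix_mul_self (hQ : IsUnit (Q.transpose * Q).det) :
    hatMatrix Q * hatMatrix Q = hatMatrix Q := by
  have h : (Q.transpose * Q)⁻¹ * (Q.transpose * Q) = 1 := Matrix.nonsing_inv_mul _ hQ
  calc hatMatrix Q * hatMatrix Q
      = Q * ((Q.transpose * Q)⁻¹ * (Q.transpose * Q)) * (Q.transpose * Q)⁻¹ * Q.transpose := by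
        simp only [hatMatrix, Matrix.mul_assoc]
    _ = hatMatrix Q := by rw [h, Matrix.mul_one, hatMatrix]

/-- The coefficients of the variance estimator as a quadratic form in the weighted statistics. -/
def varCoeff (Q : Matrix (Fin I) (Fin L) ℝ) (i k : Fin I) : ℝ :=
  (√(1 - hatMatrix Q i i))⁻¹ * (1 - hatMatrix Q) i k * (√(1 - hatMatrix Q k k))⁻¹

/-- With `P = 1 - H` a symmetric idempotent and `s_i² = 1 / P_ii ≤ 1 / δ`, the form at `m` is
`‖P(sm)‖²`. The row bound uses `∑ k, P_ik² = P_ii`. -/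
lemma isVarForm_varCoeff (hQ : IsUnit (Q.transpose * Q).det) {δ : ℝ} (hδ : 0 < δ)
    (hh : ∀ i, hatMatrix Q i i ≤ 1 - δ) : IsVarForm (varCoeff Q) δ⁻¹ := by
  set P : Matrix (Fin I) (Fin I) ℝ := 1 - hatMatrix Q with hP
  set s : Fin I → ℝ := fun i => (√(1 - hatMatrix Q i i))⁻¹ with hs
  have hsymm : ∀ i k, P i k = P k i := fun i k => by
    have : P.transpose = P := by simp [hP, transpose_hatMatrix]
    exact congrFun (congrFun this k) i
  have hidem : P * P = P := by
    simp [hP, mul_sub, sub_mul, hatMatrix_mul_self hQ]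
  have hPd : ∀ i, P i i = 1 - hatMatrix Q i i := fun i => by simp [hP]
  have hpos : ∀ i, 0 < P i i := fun i => by rw [hPd]; linarith [hh i]
  have hs2 : ∀ i, s i ^ 2 = (P i i)⁻¹ := fun i => by
    rw [hs, inv_pow, ← hPd, Real.sq_sqrt (hpos i).le]
  have hs2' : ∀ i, s i ^ 2 ≤ δ⁻¹ := fun i => by
    rw [hs2]
    exact inv_anti₀ hδ (by rw [hPd]; linarith [hh i])
  have hB : ∀ i k, varCoeff Q i k = s i * P i k * s k := fun _ _ => rfl
  have hsum : ∀ (m : Fin I → ℝ) i,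
      ∑ k, varCoeff Q i k * m k = s i * P.mulVec (fun k => s k * m k) i := fun m i => by
    simp only [hB, Matrix.mulVec, dotProduct, Finset.mul_sum]
    exact Finset.sum_congr rfl fun k _ => by ring
  have hsq : ∀ y : Fin I → ℝ, ∑ i, P.mulVec y i * y i = ∑ i, P.mulVec y i ^ 2 := fun y => by
    have h1 : ∑ i, P.mulVec y i ^ 2 = P.mulVec y ⬝ᵥ P.mulVec y := by simp [dotProduct, sq]
    have h2 : ∑ i, P.mulVec y i * y i = P.mulVec y ⬝ᵥ y := by simp [dotProduct]
    have hT : P.transpose = P := by ext i k; exact hsymm k i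
    rw [h1, h2, Matrix.dotProduct_mulVec, ← Matrix.mulVec_transpose, hT, Matrix.mulVec_mulVec,
      hidem]
  have hquad : ∀ m : Fin I → ℝ, ∑ i, (∑ k, varCoeff Q i k * m k) * m i =
      ∑ i, P.mulVec (fun k => s k * m k) i ^ 2 := fun m => by
    rw [← hsq]
    refine Finset.sum_congr rfl fun i _ => ?_
    rw [hsum]; ring
  refine ⟨fun i k => ?_, fun i => ?_, fun i => ?_, fun m => ?_, fun m => ?_, fun m => ?_⟩
  · rw [hB, hB, hsymm]; ring
  · have : s i * P i i * s i = s i ^ 2 * P i i := by ring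
    rw [hB, this, hs2, inv_mul_cancel₀ (hpos i).ne']
  · have h1 : ∑ k, P i k ^ 2 = P i i := by
      conv_rhs => rw [← hidem, Matrix.mul_apply]
      exact Finset.sum_congr rfl fun k _ => by rw [sq, hsymm k i]
    calc ∑ k, varCoeff Q i k ^ 2 ≤ ∑ k, s i ^ 2 * δ⁻¹ * P i k ^ 2 := by
          refine Finset.sum_le_sum fun k _ => ?_
          rw [hB, mul_pow, mul_pow]
          nlinarith [mul_le_mul_of_nonneg_left (hs2' k)
            (mul_nonneg (sq_nonneg (s i)) (sq_nonneg (P i k)))]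
      _ = s i ^ 2 * P i i * δ⁻¹ := by rw [← Finset.mul_sum, h1]; ring
      _ = δ⁻¹ := by rw [hs2, inv_mul_cancel₀ (hpos i).ne', one_mul]
  · rw [hquad]; exact Finset.sum_nonneg fun _ _ => sq_nonneg _
  · have h1 : ∑ i, P.mulVec (fun k => s k * m k) i ^ 2 ≤ ∑ i, (s i * m i) ^ 2 := by
      -- A projection contracts: `‖y‖² - ‖Py‖² = ‖y - Py‖²`.
      have h2 : 0 ≤ ∑ i, (s i * m i - P.mulVec (fun k => s k * m k) i) ^ 2 :=
        Finset.sum_nonneg fun _ _ => sq_nonneg _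
      have h3 := hsq fun k => s k * m k
      simp only [sub_sq, Finset.sum_add_distrib, Finset.sum_sub_distrib] at h2
      have h4 : ∑ i, 2 * (s i * m i) * P.mulVec (fun k => s k * m k) i =
          2 * ∑ i, P.mulVec (fun k => s k * m k) i * (s i * m i) := by
        rw [Finset.mul_sum]
        exact Finset.sum_congr rfl fun _ _ => by ring
      linarith
    rw [hquad, Finset.mul_sum]
    refine h1.trans (Finset.sum_le_sum fun i _ => ?_)
    rw [mul_pow]
    exact mul_le_mul_of_nonneg_right (hs2' i) (sq_nonneg _)
  · rw [hquad, Finset.mul_sum]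
    refine Finset.sum_le_sum fun i _ => ?_
    rw [hsum, mul_pow]
    exact mul_le_mul_of_nonneg_right (hs2' i) (sq_nonneg _)

end HatMatrix

/-! ### Reduction to independent sets under the sharp null. -/

namespace MatchedStudy

variable {I : ℕ} (D : MatchedStudy I)

/-- The value of `V_{F,i}` under the sharp null, as a function of the assignment in set `i`. -/
def nullV (γ : ℝ) (q₁ q₂ : Fin I → ℝ → ℝ) (i : Fin I) (a : Equiv.Perm (Fin (D.n i))) : ℝ :=
  setStat (q₁ i) (q₂ i) (fun j => D.z i (a j)) (fun j => D.r i j (D.z i j)) -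
    lpOptimum γ (q₁ i) (q₂ i) (D.z i) (fun j => D.r i j (D.z i j))

variable {D}

/-- Outcomes may be evaluated at any dose of the set, so the optimum is not random and only `π i`
matters. -/
lemma setV_eq_nullV (hD : D.SharpNull) (γ : ℝ) (q₁ q₂ : Fin I → ℝ → ℝ) (π : D.Assignment)
    (i : Fin I) : D.setV γ q₁ q₂ π i = D.nullV γ q₁ q₂ i (π i) := by
  have h : D.outcome π i = fun j => D.r i j (D.z i j) := funext fun j => hD i j _ _
  rw [setV, h]
  rfl

lemma wMean_nullV_nonpos {γ : ℝ} (hγ : 0 ≤ γ) (q₁ q₂ : Fin I → ℝ → ℝ) {u : D.Confounder}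
    (hu : ∀ i j, u i j ∈ Set.Icc (0 : ℝ) 1) (i : Fin I) :
    wMean (permProb γ (D.z i) (u i)) (D.nullV γ q₁ q₂ i) ≤ 0 := by
  unfold nullV
  rw [wMean_sub, wMean_const _ (sum_permProb _ _ _), sub_nonpos]
  exact le_lpOptimum _ _ _ (permProb_mem_lpFeasible hγ (hu i))

lemma isWeight_permProb (γ : ℝ) (u : D.Confounder) :
    IsWeight fun i => permProb γ (D.z i) (u i) :=
  ⟨fun i => permProb_nonneg γ (D.z i) (u i), fun i => sum_permProb γ (D.z i) (u i)⟩

lemma expect_eq_prodExpect (γ : ℝ) (u : D.Confounder) (f : D.Assignment → ℝ) :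
    D.expect γ u f = prodExpect (fun i => permProb γ (D.z i) (u i)) f := rfl

lemma prob_eq_prodProb (γ : ℝ) (u : D.Confounder) (A : Set D.Assignment) :
    D.prob γ u A = prodProb (fun i => permProb γ (D.z i) (u i)) A := by
  classical
  rw [prob, prodProb, prodExpect, Finset.sum_filter]
  refine Finset.sum_congr rfl fun π _ => ?_
  by_cases h : π ∈ A <;> simp [h, assignProb]

lemma bigV_eq_sum (hD : D.SharpNull) (γ : ℝ) (q₁ q₂ : Fin I → ℝ → ℝ) (w : Fin I → ℝ)
    (π : D.Assignment) :
    D.bigV γ q₁ q₂ w π = ∑ i, (I : ℝ)⁻¹ * (w i * D.nullV γ q₁ q₂ i (π i)) := by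
  simp only [bigV, Finset.mul_sum, setV_eq_nullV hD]

lemma variance_bigV (hD : D.SharpNull) (γ : ℝ) (q₁ q₂ : Fin I → ℝ → ℝ) (w : Fin I → ℝ)
    (u : D.Confounder) :
    D.variance γ u (D.bigV γ q₁ q₂ w) = ∑ i, wMean (permProb γ (D.z i) (u i)) (fun a =>
      ((I : ℝ)⁻¹ * (w i * D.nullV γ q₁ q₂ i a) - wMean (permProb γ (D.z i) (u i))
        fun a => (I : ℝ)⁻¹ * (w i * D.nullV γ q₁ q₂ i a)) ^ 2) := by
  have hw := isWeight_permProb γ u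
  rw [← prodExpect_sum_sq hw (X := fun i a => (I : ℝ)⁻¹ * (w i * D.nullV γ q₁ q₂ i a) -
    wMean (permProb γ (D.z i) (u i)) fun a => (I : ℝ)⁻¹ * (w i * D.nullV γ q₁ q₂ i a))
    fun i => by rw [wMean_sub, wMean_const _ (hw.sum_eq_one i), sub_self]]
  have hmean : D.expect γ u (D.bigV γ q₁ q₂ w) = ∑ i, wMean (permProb γ (D.z i) (u i))
      fun a => (I : ℝ)⁻¹ * (w i * D.nullV γ q₁ q₂ i a) := by
    have : D.bigV γ q₁ q₂ w = fun π => ∑ i, (I : ℝ)⁻¹ * (w i * D.nullV γ q₁ q₂ i (π i)) :=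
      funext (bigV_eq_sum hD γ q₁ q₂ w)
    rw [expect_eq_prodExpect, this, prodExpect_sum]
    exact Finset.sum_congr rfl fun i _ => prodExpect_eval hw i
      fun a => (I : ℝ)⁻¹ * (w i * D.nullV γ q₁ q₂ i a)
  rw [variance, hmean, expect_eq_prodExpect]
  simp only [bigV_eq_sum hD, Finset.sum_sub_distrib]

lemma varEstimator_eq (hD : D.SharpNull) (γ : ℝ) (q₁ q₂ : Fin I → ℝ → ℝ) (w : Fin I → ℝ)
    {L : ℕ} (Q : Matrix (Fin I) (Fin L) ℝ) (π : D.Assignment) :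
    D.varEstimator γ q₁ q₂ w Q π =
      ∑ i, (∑ k, varCoeff Q i k * ((I : ℝ)⁻¹ * (w k * D.nullV γ q₁ q₂ k (π k)))) *
        ((I : ℝ)⁻¹ * (w i * D.nullV γ q₁ q₂ i (π i))) := by
  simp only [varEstimator, dotProduct, Matrix.mulVec, Matrix.mul_diagonal, Matrix.diagonal_mul,
    leverageAdjusted, setV_eq_nullV hD, varCoeff, Finset.mul_sum, Finset.sum_mul]
  refine Finset.sum_congr rfl fun i _ => Finset.sum_congr rfl fun k _ => ?_
  simp only [div_eq_mul_inv]
  ring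

end MatchedStudy

/-! ### Standardization by the true standard deviation. -/

namespace MatchedStudy

variable {I : ℕ} (D : MatchedStudy I)

/-- The contribution of set `i` to `V_F`, divided by the standard deviation of `V_F`. -/
def scaledV (γ : ℝ) (q₁ q₂ : Fin I → ℝ → ℝ) (w : Fin I → ℝ) (u : D.Confounder) (i : Fin I)
    (a : Equiv.Perm (Fin (D.n i))) : ℝ :=
  (√(D.variance γ u (D.bigV γ q₁ q₂ w)))⁻¹ * ((I : ℝ)⁻¹ * (w i * D.nullV γ q₁ q₂ i a))

variable {D} {γ : ℝ} {q₁ q₂ : Fin I → ℝ → ℝ} {w : Fin I → ℝ} {u : D.Confounder}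

lemma wMean_scaledV_nonpos (hγ : 0 ≤ γ) (hw : ∀ i, 0 ≤ w i)
    (hu : ∀ i j, u i j ∈ Set.Icc (0 : ℝ) 1) (i : Fin I) :
    wMean (permProb γ (D.z i) (u i)) (D.scaledV γ q₁ q₂ w u i) ≤ 0 := by
  unfold scaledV
  rw [wMean_const_mul, wMean_const_mul, wMean_const_mul]
  refine mul_nonpos_of_nonneg_of_nonpos (inv_nonneg.2 (Real.sqrt_nonneg _))
    (mul_nonpos_of_nonneg_of_nonpos (inv_nonneg.2 (Nat.cast_nonneg _))
      (mul_nonpos_of_nonneg_of_nonpos (hw i) (wMean_nullV_nonpos hγ q₁ q₂ hu i)))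

lemma sum_variance_scaledV (hD : D.SharpNull)
    (hV : 0 < D.variance γ u (D.bigV γ q₁ q₂ w)) :
    ∑ i, wMean (permProb γ (D.z i) (u i)) (fun a => (D.scaledV γ q₁ q₂ w u i a -
      wMean (permProb γ (D.z i) (u i)) (D.scaledV γ q₁ q₂ w u i)) ^ 2) = 1 := by
  have h := variance_bigV hD γ q₁ q₂ w u
  unfold scaledV
  set v := D.variance γ u (D.bigV γ q₁ q₂ w)
  have e : ∀ i, wMean (permProb γ (D.z i) (u i)) (fun a =>
      ((√v)⁻¹ * ((I : ℝ)⁻¹ * (w i * D.nullV γ q₁ q₂ i a)) -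
        wMean (permProb γ (D.z i) (u i)) fun a =>
          (√v)⁻¹ * ((I : ℝ)⁻¹ * (w i * D.nullV γ q₁ q₂ i a))) ^ 2) =
      v⁻¹ * wMean (permProb γ (D.z i) (u i)) (fun a =>
      ((I : ℝ)⁻¹ * (w i * D.nullV γ q₁ q₂ i a) - wMean (permProb γ (D.z i) (u i))
        fun a => (I : ℝ)⁻¹ * (w i * D.nullV γ q₁ q₂ i a)) ^ 2) := fun i => by
    rw [wMean_const_mul _ (√v)⁻¹]
    simp only [← mul_sub, mul_pow (√v)⁻¹, inv_pow, Real.sq_sqrt hV.le]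
    rw [wMean_const_mul]
  simp only [e, ← Finset.mul_sum]
  rw [← h, inv_mul_cancel₀ hV.ne']

lemma sum_scaledV_pow_four (hD : D.SharpNull)
    (hV : 0 < D.variance γ u (D.bigV γ q₁ q₂ w)) :
    ∑ i, wMean (permProb γ (D.z i) (u i)) (fun a => D.scaledV γ q₁ q₂ w u i a ^ 4) =
      (∑ i, D.expect γ u (fun π => ((I : ℝ)⁻¹ * (w i * D.setV γ q₁ q₂ π i)) ^ 4)) /
        D.variance γ u (D.bigV γ q₁ q₂ w) ^ 2 := by
  unfold scaledV
  set v := D.variance γ u (D.bigV γ q₁ q₂ w)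
  rw [div_eq_inv_mul, Finset.mul_sum]
  refine Finset.sum_congr rfl fun i _ => ?_
  have h4 : (√v) ^ 4 = v ^ 2 := by
    rw [show 4 = 2 * 2 by norm_num, pow_mul, Real.sq_sqrt hV.le]
  simp only [mul_pow (√v)⁻¹, inv_pow, h4, wMean_const_mul]
  congr 1
  rw [expect_eq_prodExpect]
  simp only [setV_eq_nullV hD]
  exact (prodExpect_eval (isWeight_permProb γ u) i
    fun a => ((I : ℝ)⁻¹ * (w i * D.nullV γ q₁ q₂ i a)) ^ 4).symm

/-- The studentized ratio is invariant under positive rescaling of the contributions. -/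
lemma studentized_bigV_eq (hD : D.SharpNull) (hV : 0 < D.variance γ u (D.bigV γ q₁ q₂ w))
    {L : ℕ} (Q : Matrix (Fin I) (Fin L) ℝ) (π : D.Assignment) :
    D.bigV γ q₁ q₂ w π / √(D.varEstimator γ q₁ q₂ w Q π) =
      (∑ i, D.scaledV γ q₁ q₂ w u i (π i)) / √(∑ i, (∑ k, varCoeff Q i k *
        D.scaledV γ q₁ q₂ w u k (π k)) * D.scaledV γ q₁ q₂ w u i (π i)) := by
  unfold scaledV
  set v := D.variance γ u (D.bigV γ q₁ q₂ w)
  have hs : 0 < (√v)⁻¹ := inv_pos.2 (Real.sqrt_pos.2 hV)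
  have e : ∑ i, (∑ k, varCoeff Q i k * ((√v)⁻¹ * ((I : ℝ)⁻¹ * (w k * D.nullV γ q₁ q₂ k (π k))))) *
      ((√v)⁻¹ * ((I : ℝ)⁻¹ * (w i * D.nullV γ q₁ q₂ i (π i)))) =
      (√v)⁻¹ ^ 2 * D.varEstimator γ q₁ q₂ w Q π := by
    rw [varEstimator_eq hD, Finset.mul_sum]
    refine Finset.sum_congr rfl fun i _ => ?_
    rw [Finset.sum_mul, Finset.sum_mul, Finset.mul_sum]
    exact Finset.sum_congr rfl fun k _ => by ring
  rw [e, Real.sqrt_mul (sq_nonneg _), Real.sqrt_sq hs.le, ← Finset.mul_sum, ← bigV_eq_sum hD,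
    mul_div_mul_left _ _ hs.ne']

end MatchedStudy

/-! ### Asymptotic tails of studentized sums. -/

section Asymptotic

open ProbabilityTheory

lemma tendsto_centered_pow_four {ι : ℕ → Type*} [∀ n, Fintype (ι n)]
    {Ω : ∀ n, ι n → Type*} [∀ n i, Fintype (Ω n i)] {p : ∀ n i, Ω n i → ℝ}
    (hp : ∀ n, IsWeight (p n)) {x : ∀ n i, Ω n i → ℝ}
    (h4 : Tendsto (fun n => ∑ i, wMean (p n i) (fun a => x n i a ^ 4)) atTop (𝓝 0)) :
    Tendsto (fun n => ∑ i, wMean (p n i) (fun a => (x n i a - wMean (p n i) (x n i)) ^ 4))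
      atTop (𝓝 0) := by
  refine squeeze_zero (fun n => Finset.sum_nonneg fun i _ => wMean_nonneg _ ((hp n).nonneg i)
    fun _ => by positivity) (fun n => ?_) (by simpa using h4.const_mul 16)
  rw [Finset.mul_sum]
  exact Finset.sum_le_sum fun i _ =>
    wMean_centered_pow_four_le _ ((hp n).nonneg i) ((hp n).sum_eq_one i) _

/-- The upper tail of a studentized sum of independent variables with nonpositive means is
asymptotically no heavier than the normal tail. -/
theorem eventually_prodProb_studentized_le {ι : ℕ → Type*} [∀ n, Fintype (ι n)]
    [∀ n, DecidableEq (ι n)] {Ω : ∀ n, ι n → Type*} [∀ n i, Fintype (Ω n i)]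
    {p : ∀ n i, Ω n i → ℝ} (hp : ∀ n, IsWeight (p n)) {x : ∀ n i, Ω n i → ℝ}
    (hm : ∀ n i, wMean (p n i) (x n i) ≤ 0)
    (hvar : ∀ᶠ n in atTop,
      ∑ i, wMean (p n i) (fun a => (x n i a - wMean (p n i) (x n i)) ^ 2) = 1)
    (h4 : Tendsto (fun n => ∑ i, wMean (p n i) (fun a => x n i a ^ 4)) atTop (𝓝 0))
    {B : ∀ n, ι n → ι n → ℝ} {C : ℝ} (hC : 0 ≤ C) (hB : ∀ᶠ n in atTop, IsVarForm (B n) C)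
    {a b c : ℝ} (hab : b < a) (hc : 1 - cdf (gaussianReal 0 1) b < c) :
    ∀ᶠ n in atTop, prodProb (p n) {ω | a ≤ (∑ i, x n i (ω i)) /
      √(∑ i, (∑ k, B n i k * x n k (ω k)) * x n i (ω i))} ≤ c := by
  set M : ℕ → ℝ := fun n => ∑ i, wMean (p n i) (fun a => x n i a ^ 4) with hM
  have hM0 : ∀ n, 0 ≤ M n := fun n => Finset.sum_nonneg fun i _ =>
    wMean_nonneg _ ((hp n).nonneg i) fun _ => by positivity
  -- The fourth root of the fourth-moment sum bounds every `|m_i|`.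
  set e : ℕ → ℝ := fun n => √√(M n) with he
  have he4 : ∀ n, e n ^ 4 = M n := fun n => by
    rw [he, show 4 = 2 * 2 by norm_num, pow_mul, Real.sq_sqrt (Real.sqrt_nonneg _),
      Real.sq_sqrt (hM0 n)]
  have hlim : Tendsto e atTop (𝓝 0) := by
    have := (Real.continuous_sqrt.comp Real.continuous_sqrt).tendsto 0
    simpa [Function.comp_def] using this.comp h4
  -- `η` depends only on `a` and `b`, so the error terms vanish as `e n → 0`; using `|a| + 1` covers
  -- `a = 0`.
  obtain ⟨η, hη0, hη, hηa, hηab⟩ : ∃ η : ℝ, 0 < η ∧ η ≤ 1 / 8 ∧ η * |a| ≤ 1 ∧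
      4 * η * |a| ≤ a - b := by
    have ha : 0 < |a| + 1 := by positivity
    have hd : 0 < a - b := sub_pos.2 hab
    refine ⟨min (1 / 8) (min (1 / (|a| + 1)) ((a - b) / (4 * (|a| + 1)))), by positivity,
      min_le_left _ _, ?_, ?_⟩
    · have h : min (1 / 8) (min (1 / (|a| + 1)) ((a - b) / (4 * (|a| + 1)))) ≤ 1 / (|a| + 1) :=
        (min_le_right _ _).trans (min_le_left _ _)
      rw [le_div_iff₀ ha] at h
      have : 0 ≤ min (1 / 8) (min (1 / (|a| + 1)) ((a - b) / (4 * (|a| + 1)))) := by positivity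
      linarith
    · have h : min (1 / 8) (min (1 / (|a| + 1)) ((a - b) / (4 * (|a| + 1)))) ≤
        (a - b) / (4 * (|a| + 1)) := (min_le_right _ _).trans (min_le_right _ _)
      rw [le_div_iff₀ (by positivity)] at h
      have : 0 ≤ min (1 / 8) (min (1 / (|a| + 1)) ((a - b) / (4 * (|a| + 1)))) := by positivity
      linarith
  have hclt := tendsto_prodProb_of_lyapunov hp
    (X := fun n i a => x n i a - wMean (p n i) (x n i))
    (fun n i => by rw [wMean_sub, wMean_const _ ((hp n).sum_eq_one i), sub_self]) hvar
    (tendsto_centered_pow_four hp h4) b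
  have herr : Tendsto (fun n => (32 * C * e n ^ 4 + 16 * e n ^ 4 + 4 * C * e n ^ 2) / η ^ 2)
      atTop (𝓝 0) := by
    have hcont : Continuous fun y : ℝ =>
        (32 * C * y ^ 4 + 16 * y ^ 4 + 4 * C * y ^ 2) / η ^ 2 := by fun_prop
    simpa [Function.comp_def] using (hcont.tendsto 0).comp hlim
  have hsum := hclt.add herr
  rw [add_zero] at hsum
  have hCe : ∀ᶠ n in atTop, C * e n ≤ η := by
    have : Tendsto (fun n => C * e n) atTop (𝓝 0) := by simpa using hlim.const_mul C
    exact (this.eventually (gt_mem_nhds hη0)).mono fun _ h => h.le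
  filter_upwards [hvar, hB, hCe, hsum.eventually (gt_mem_nhds hc)] with n h1 h2 h3 h5
  exact (prodProb_studentized_le (hp n) (hm n) h1 h2 hC hη0 hη hηa hηab
    (Real.sqrt_nonneg _) (he4 n).ge h3).trans h5.le

end Asymptotic

end DoseSensitivity

end

open DoseSensitivity DoseSensitivity.MatchedStudy ProbabilityTheory in
theorem mainTheorem1
    (γ : ℝ) (hγ : 0 ≤ γ)
    (D : (I : ℕ) → DoseSensitivity.MatchedStudy I)
    (hD : ∀ I, (D I).SharpNull)
    (q₁ q₂ : (I : ℕ) → Fin I → ℝ → ℝ)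
    (w : (I : ℕ) → Fin I → ℝ) (hw : ∀ I i, 0 ≤ w I i)
    {L : ℕ → ℕ} (Q : (I : ℕ) → Matrix (Fin I) (Fin (L I)) ℝ)
    (hQ : DoseSensitivity.DesignRegular Q)
    (u : (I : ℕ) → (D I).Confounder)
    (hu : ∀ I i j, u I i j ∈ Set.Icc (0 : ℝ) 1)
    (hreg : DoseSensitivity.MomentRegular γ D q₁ q₂ w u)
    (α : ℝ) (hα : α ∈ Set.Ioo (0 : ℝ) 1) :
    limsup (fun I : ℕ =>
      (D I).prob γ (u I) {π | (D I).pBar γ (q₁ I) (q₂ I) (w I) (Q I) π ≤ α}) atTop ≤ α := by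
  obtain ⟨-, hdet, δ, hδ, hh⟩ := hQ
  obtain ⟨hV, hM⟩ := hreg
  refine le_of_forall_gt_imp_ge_of_dense fun c hc => ?_
  obtain ⟨ε, hε, hεc, hε1⟩ : ∃ ε : ℝ, 0 < ε ∧ 2 * ε < c - α ∧ 2 * ε < 1 - α := by
    have h1 := sub_pos.2 hc
    have h2 := sub_pos.2 hα.2
    refine ⟨min (c - α) (1 - α) / 4, by positivity, ?_, ?_⟩
    · linarith [min_le_left (c - α) (1 - α), lt_min h1 h2]
    · linarith [min_le_right (c - α) (1 - α), lt_min h1 h2]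
  -- Two levels just below `1 - α`: the gap from `1 - α` to `Φ(a)` and from `Φ(a)` to `Φ(b)` yields
  -- strict inequalities from mere monotonicity of `Φ`, and the limiting tail at `b` is `α + 2ε <
  -- c`.
  obtain ⟨a, ha⟩ := exists_cdf_gaussianReal_eq (y := 1 - α - ε)
    ⟨by linarith, by linarith [hα.1]⟩
  obtain ⟨b, hb⟩ := exists_cdf_gaussianReal_eq (y := 1 - α - 2 * ε)
    ⟨by linarith, by linarith [hα.1]⟩
  have hmono := monotone_cdf (gaussianReal 0 1)
  have hab : b < a := hmono.reflect_lt (by rw [ha, hb]; linarith)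
  have key := eventually_prodProb_studentized_le
    (fun I => isWeight_permProb γ (u I))
    (x := fun I i => (D I).scaledV γ (q₁ I) (q₂ I) (w I) (u I) i)
    (fun I i => wMean_scaledV_nonpos hγ (hw I) (hu I) i)
    (hV.mono fun I h => sum_variance_scaledV (hD I) h)
    (hM.congr' (hV.mono fun I h => (sum_scaledV_pow_four (hD I) h).symm))
    (B := fun I => varCoeff (Q I)) (inv_nonneg.2 hδ.le)
    ((hdet.and hh).mono fun I h => isVarForm_varCoeff h.1 hδ h.2) hab
    (c := c) (by rw [hb]; linarith)
  refine limsup_le_of_le ?_ ?_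
  -- A real `limsup` needs this side condition; probabilities are bounded below by zero.
  · refine isCoboundedUnder_le_of_le atTop (x := 0) fun I => ?_
    rw [prob_eq_prodProb]
    exact prodProb_nonneg (isWeight_permProb γ (u I)) _
  · filter_upwards [key, hV] with I hI hVI
    rw [prob_eq_prodProb]
    refine (prodProb_mono (isWeight_permProb γ (u I)) fun π hπ => ?_).trans hI
    have hπ' : (D I).pBar γ (q₁ I) (q₂ I) (w I) (Q I) π ≤ α := hπ
    rw [pBar, studentized_bigV_eq (hD I) hVI] at hπ'
    -- `p ≤ α` means `Φ` of the statistic is at least `1 - α > Φ(a)`.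
    exact (hmono.reflect_lt (by rw [ha]; linarith)).le
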